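/- Let $n\ge 3$ and let $C=K_n+_{\cdot}K_3$ be the graph of order $n+2$ consisting of a complete graph $K_n$ and a triangle with exactly one vertex in common. Let $\mathcal G_C$ be the class of countable graphs with no subgraph (induced or not) isomorphic to $C$. Let $\mathcal E_C$ be the class of existentially complete members of $\mathcal G_C$, that is, of those $G\in\mathcal G_C$ such that, whenever $G$ is an induced subgraph of some $H\in\mathcal G_C$, every existential first-order statement in the language of graphs with parameters in $G$ that is true in $H$ is true in $G$. Let $T^*_C$ be the first-order theory of $\mathcal E_C$, i.e. the set of sentences true in all graphs in $\mathcal E_C$. For $G\in\mathcal E_C$ and $A\subseteq V(G)$, let $\mathrm{acl}(A)$ be the set of vertices $b$ for which there is an existential formula $\varphi(x,\bar a)$ with parameters $\bar a$ in $A$ that has only finitely many solutions $x$ in $G$, one of which is $b$. Call a finite set $B\subseteq V(G)$ special if it induces a complete graph and either $|B|=n$ and no set $B'\ne B$ of $n$ vertices that induces a complete graph meets $B$, or $|B|=n-1$ and at least two vertices of $G$ are adjacent to all vertices of $B$. For $a\in V(G)$, let $a^*$ be the union of all special sets $B$ such that $\{a\}\cup B$ induces a complete graph. Then: 1. For every $G\in\mathcal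 E_C$ and every $A\subseteq V(G)$, $A=\mathrm{acl}(A)$ if and only if $a^*\subseteq A$ for every $a\in A$. 2. For every $G\in\mathcal E_C$ and every $a\in V(G)$, $|\{a\}\cup a^*|\le n+1$. 3. For every $G\in\mathcal E_C$ and every $A\subseteq V(G)$, $|\mathrm{acl}(A)|\le (n+1)|A|$. 4. $T^*_C$ is $\aleph_0$-categorical, i.e. it has exactly one countable model up to isomorphism. 5. There is a universal graph in $\mathcal G_C$, i.e. a graph in $\mathcal G_C$ that contains every graph in $\mathcal G_C$ as an induced subgraph, up to isomorphism. -/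

import Mathlib

open FirstOrder

universe u v

namespace UniversalGraphs

/-- The graph `K_n +· K_3`, for `n ≥ 1`, on the vertices `0, …, n + 1`: a complete graph on
`{0, …, n - 1}` and a triangle on `{n - 1, n, n + 1}`, with exactly the vertex `n - 1` in
common. -/
def cliqueWithTriangle (n : ℕ) : SimpleGraph (Fin (n + 2)) where
  Adj i j := i ≠ j ∧ ((i.val < n ∧ j.val < n) ∨ (n ≤ i.val + 1 ∧ n ≤ j.val + 1))
  symm := ⟨fun _ _ h => ⟨h.1.symm, h.2.imp And.symm And.symm⟩⟩
  loopless := ⟨fun _ h => h.1 rfl⟩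

section Classes

variable {W : Type v}

/-- `G` satisfies the first-order formula `φ` of the language of graphs under the
assignment `x`. -/
def Realizes {V : Type u} (G : SimpleGraph V) {α : Type v} (φ : Language.graph.Formula α)
    (x : α → V) : Prop :=
  @Language.Formula.Realize Language.graph V G.structure α φ x

/-- The class `𝒢_C`: countable graphs with no subgraph (induced or not) isomorphic to `C`. -/
def IsCountableFree (C : SimpleGraph W) {V : Type u} (G : SimpleGraph V) : Prop :=
  Countable V ∧ C.Free G

/-- `G` is existentially complete in `H`, where `e` identifies `G` with an induced subgraph
of `H`: every existential statement with parameters in `G` that is true in `H` is true in `G`. -/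
def IsExistentiallyCompleteIn {V V' : Type u} (G : SimpleGraph V) (H : SimpleGraph V')
    (e : G ↪g H) : Prop :=
  ∀ (m : ℕ) (φ : Language.graph.Formula (Fin m)) (a : Fin m → V),
    φ.IsExistential → Realizes H φ (fun i => e (a i)) → Realizes G φ a

/-- The class `ℰ_C`: graphs in `𝒢_C` that are existentially complete in every graph of `𝒢_C`
that contains them as an induced subgraph. -/
def IsExistentiallyComplete (C : SimpleGraph W) {V : Type u} (G : SimpleGraph V) : Prop :=
  IsCountableFree C G ∧
    ∀ (V' : Type u) (H : SimpleGraph V') (e : G ↪g H),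
      IsCountableFree C H → IsExistentiallyCompleteIn G H e

/-- `T*_C`, the first-order theory of the class `ℰ_C`. -/
def theoryOfExistentiallyComplete (C : SimpleGraph W) : Language.graph.Theory :=
  {φ | ∀ (V : Type u) (G : SimpleGraph V), IsExistentiallyComplete C G →
    @Language.Sentence.Realize Language.graph V G.structure φ}

/-- `T` has exactly one countable model up to isomorphism. -/
def IsAleph0Categorical (T : Language.graph.Theory) : Prop :=
  (∃ M : T.ModelType, Countable (M : Type u)) ∧
    ∀ M N : T.ModelType, Countable (M : Type u) → Countable (N : Type u) →
      Nonempty ((M : Type u) ≃[Language.graph] (N : Type u))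

/-- `U` is universal for `𝒢_C`: it belongs to `𝒢_C`, and every graph in `𝒢_C` is isomorphic to
an induced subgraph of `U`. -/
def IsUniversalFor (C : SimpleGraph W) {V : Type u} (U : SimpleGraph V) : Prop :=
  IsCountableFree C U ∧
    ∀ (V' : Type u) (H : SimpleGraph V'), IsCountableFree C H → Nonempty (H ↪g U)

end Classes

section Closure

variable {V : Type u} (G : SimpleGraph V)

/-- The algebraic closure of `A` in `G`: all `b` that satisfy some existential formula
`φ(x, a₁, …, a_m)` with parameters in `A` that has only finitely many solutions `x` in `G`. -/
def acl (A : Set V) : Set V :=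
  {b | ∃ (m : ℕ) (φ : Language.graph.Formula (Fin (m + 1))) (a : Fin m → V),
    φ.IsExistential ∧ (∀ i, a i ∈ A) ∧
    {x : V | Realizes G φ (Fin.cons x a : Fin (m + 1) → V)}.Finite ∧
    Realizes G φ (Fin.cons b a : Fin (m + 1) → V)}

/-- A finite clique `A` is special (relative to `n`) if either `|A| = n` and no other clique of
order `n` meets `A`, or `|A| = n - 1` and at least two vertices are adjacent to all of `A`. -/
def IsSpecial (n : ℕ) (A : Finset V) : Prop :=
  G.IsClique (A : Set V) ∧
    ((A.card = n ∧
        ¬ ∃ B : Finset V, B.card = n ∧ B ≠ A ∧ (∃ x, x ∈ B ∧ x ∈ A) ∧ G.IsClique (B : Set V)) ∨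
      (A.card + 1 = n ∧
        ∃ x y : V, x ≠ y ∧ (∀ v ∈ A, G.Adj x v) ∧ (∀ v ∈ A, G.Adj y v)))

/-- `a*`: the union of the special sets `B` such that `{a} ∪ B` is a clique. -/
def star (n : ℕ) (a : V) : Set V :=
  {b | ∃ B : Finset V, IsSpecial G n B ∧ G.IsClique (insert a (B : Set V)) ∧ b ∈ B}

end Closure

end UniversalGraphs

open UniversalGraphs

/-! A graph is `C`-free iff no triangle meets an `n`-clique in exactly one vertex. So a clique
through a vertex of an `n`-clique `Q` has at most one vertex outside `Q`, and the `n`-cliques fall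
into three kinds of cluster: those inside an `(n + 1)`-clique, those sharing a kernel of order `n -
1` whose other neighbours are pairwise non-adjacent, and isolated ones. Hence `a*` is an `(n +
1)`-clique, a kernel, an isolated clique or empty (`star_cases`), which gives the bound `n + 1` and
shows that sets of the form `{a} ∪ a*` are closed under `*`.

The heart is amalgamation (`IsFreeAmalgam.cliqueTriangleFree`): two `C`-free graphs glued along
parts closed under `*`, with the same kernels, have a `C`-free union. Agreement on kernels is a
separate condition because the two vertices witnessing a kernel may lie outside the common part.
Gluing `G` to itself over a closed `A` produces a fresh copy of any `b` outside `A`, so `b` is not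
algebraic over `A`; conversely special sets are found existentially, so `a*` is algebraic over `a`.

Existential completeness is used as `HasFiniteRetractions`: finite parts of any `C`-free countable
extension embed back into `G`, fixing what was already in `G`. A back-and-forth through finite
closed partial isomorphisms then shows that all existentially complete graphs are isomorphic. To
extend such a map, amalgamate, retract a large finite set, and use `exists_finset_reflecting` (an
ultrapower argument) to ensure that the image is again closed. A generic construction embeds each
member of the class in an existentially complete one, so the unique existentially complete graph is
universal. Since `C` is finite, existential completeness of countable graphs is expressed by
first-order sentences, so the countable models of the theory are existentially complete and
categoricity follows. -/

namespace UniversalGraphs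

/-! ### Equality and adjacency patterns of tuples. -/

section Patterns

/-- `h` restricts to an isomorphism from the subgraph of `H` induced on `S` to an induced
subgraph of `G`. -/
def IsEmbeddingOn {V' V : Type*} (H : SimpleGraph V') (G : SimpleGraph V) (S : Set V')
    (h : V' → V) : Prop :=
  Set.InjOn h S ∧ ∀ x ∈ S, ∀ y ∈ S, G.Adj (h x) (h y) ↔ H.Adj x y

lemma IsEmbeddingOn.mono {V' V : Type*} {H : SimpleGraph V'} {G : SimpleGraph V} {S T : Set V'}
    {h : V' → V} (hh : IsEmbeddingOn H G T h) (hST : S ⊆ T) : IsEmbeddingOn H G S h :=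
  ⟨hh.1.mono hST, fun x hx y hy => hh.2 x (hST hx) y (hST hy)⟩

/-- The equalities and adjacencies that may hold among the entries of a tuple. -/
abbrev Pattern (ι : Type*) := (ι → ι → Prop) × (ι → ι → Prop)

/-- The equalities and adjacencies among the entries of a tuple of vertices. -/
def pattern {V ι : Type*} (G : SimpleGraph V) (t : ι → V) : Pattern ι :=
  (fun i j => t i = t j, fun i j => G.Adj (t i) (t j))

lemma pattern_eq_iff {V W ι : Type*} {G : SimpleGraph V} {H : SimpleGraph W} {t : ι → V}
    {s : ι → W} : pattern G t = pattern H s ↔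
      ∀ i j, (t i = t j ↔ s i = s j) ∧ (G.Adj (t i) (t j) ↔ H.Adj (s i) (s j)) := by
  simp only [pattern, Prod.mk.injEq, funext_iff, eq_iff_iff]
  exact ⟨fun h i j => ⟨h.1 i j, h.2 i j⟩, fun h => ⟨fun i j => (h i j).1, fun i j => (h i j).2⟩⟩

lemma pattern_comp_eq {V W ι κ : Type*} {G : SimpleGraph V} {H : SimpleGraph W} {t : ι → V}
    {s : ι → W} (h : pattern G t = pattern H s) (ρ : κ → ι) :
    pattern G (t ∘ ρ) = pattern H (s ∘ ρ) := by
  rw [pattern_eq_iff] at h ⊢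
  exact fun i j => h (ρ i) (ρ j)

lemma IsEmbeddingOn.pattern_eq {V W ι : Type*} {H : SimpleGraph W} {G : SimpleGraph V}
    {S : Set W} {h : W → V} (hh : IsEmbeddingOn H G S h) {s : ι → W} (hs : ∀ i, s i ∈ S) :
    pattern G (h ∘ s) = pattern H s := by
  rw [pattern_eq_iff]
  exact fun i j => ⟨⟨fun e => hh.1 (hs i) (hs j) e, fun e => congrArg h e⟩,
    hh.2 _ (hs i) _ (hs j)⟩

lemma pattern_embedding {V W ι : Type*} {G : SimpleGraph V} {H : SimpleGraph W}
    (e : G ↪g H) (t : ι → V) : pattern H (e ∘ t) = pattern G t := by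
  rw [pattern_eq_iff]
  exact fun i j => ⟨e.injective.eq_iff, e.map_adj_iff⟩

/-- Tuples with the same pattern are exchanged by a map that is an embedding on them. -/
lemma exists_isEmbeddingOn_of_pattern_eq {V W ι : Type*} [Nonempty V] {G : SimpleGraph V}
    {H : SimpleGraph W} {t : ι → V} {s : ι → W} (h : pattern G t = pattern H s) :
    ∃ f : W → V, IsEmbeddingOn H G (Set.range s) f ∧ ∀ i, f (s i) = t i := by
  classical
  rw [pattern_eq_iff] at h
  have hf : ∀ i, Function.extend s t (fun _ => Classical.arbitrary V) (s i) = t i := by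
    intro i
    have : ∃ j, s j = s i := ⟨i, rfl⟩
    rw [Function.extend_def, dif_pos this]
    exact ((h _ _).1).2 (Classical.choose_spec this)
  refine ⟨_, ⟨?_, ?_⟩, hf⟩
  · rintro _ ⟨i, rfl⟩ _ ⟨j, rfl⟩ e
    rw [hf, hf] at e
    exact (h i j).1.1 e
  · rintro _ ⟨i, rfl⟩ _ ⟨j, rfl⟩
    rw [hf, hf]
    exact (h i j).2

lemma pattern_eq_of_elim {V ι κ : Type*} {W : Type*} {G : SimpleGraph V} {H : SimpleGraph W}
    {t : ι → V} {s : ι → W} {t' : κ → V} {s' : κ → W}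
    (h : pattern G (Sum.elim t t') = pattern H (Sum.elim s s')) : pattern G t = pattern H s :=
  pattern_comp_eq h Sum.inl

end Patterns

/-! ### Patterns against quantifier-free and existential formulas. -/

section Formulas

open Language BoundedFormula

lemma isQF_iInf {L : Language} {α β : Type*} [Finite β] {n : ℕ} (f : β → L.BoundedFormula α n)
    (h : ∀ b, (f b).IsQF) : (BoundedFormula.iInf f).IsQF := by
  unfold BoundedFormula.iInf
  simp only
  generalize (@Finset.univ β (Fintype.ofFinite β)).toList = l
  induction l with
  | nil => exact IsQF.top
  | cons a l ih => exact (h a).inf ih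

lemma isQF_iSup {L : Language} {α β : Type*} [Finite β] {n : ℕ} (f : β → L.BoundedFormula α n)
    (h : ∀ b, (f b).IsQF) : (BoundedFormula.iSup f).IsQF := by
  unfold BoundedFormula.iSup
  simp only
  generalize (@Finset.univ β (Fintype.ofFinite β)).toList = l
  induction l with
  | nil => exact isQF_bot
  | cons a l ih => exact (h a).sup ih

lemma isExistential_exs {L : Language} {α : Type*} {n : ℕ} {φ : L.BoundedFormula α n}
    (h : φ.IsExistential) : φ.exs.IsExistential := by
  induction n with
  | zero => exact h
  | succ n ih => exact ih h.ex

lemma isExistential_iExs {L : Language} {α β : Type*} [Finite β] {φ : L.Formula (α ⊕ β)}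
    (h : φ.IsQF) : (φ.iExs β).IsExistential :=
  isExistential_exs (IsQF.isExistential (h.relabel _))

/-- Every property of the pattern of a finite tuple is defined by a quantifier-free formula. -/
lemma exists_isQF_realizes_iff {ι : Type v} [Finite ι] (P : Set (Pattern ι)) :
    ∃ θ : Language.graph.Formula ι, θ.IsQF ∧ ∀ (V : Type u) (G : SimpleGraph V) (t : ι → V),
      Realizes G θ t ↔ pattern G t ∈ P := by
  classical
  let lit (c : Prop) (ψ : Language.graph.Formula ι) : Language.graph.Formula ι :=
    if c then ψ else ψ.not
  have lit_qf : ∀ c (ψ : Language.graph.Formula ι), ψ.IsQF → (lit c ψ).IsQF := by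
    intro c ψ h
    by_cases hc : c <;> simp only [lit, hc, if_true, if_false]
    exacts [h, h.not]
  have lit_real : ∀ (V : Type u) (G : SimpleGraph V) (t : ι → V) c
      (ψ : Language.graph.Formula ι), Realizes G (lit c ψ) t ↔ (Realizes G ψ t ↔ c) := by
    intro V G t c ψ
    let := G.structure
    by_cases hc : c <;> simp [lit, hc, Realizes, Formula.realize_not]
  let eqf (p : ι × ι) : Language.graph.Formula ι := Term.equal (Term.var p.1) (Term.var p.2)
  let adjf (p : ι × ι) : Language.graph.Formula ι :=
    Relations.formula₂ Language.adj (Term.var p.1) (Term.var p.2)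
  have eq_qf : ∀ p, (eqf p).IsQF := fun p => (IsAtomic.equal _ _).isQF
  have adj_qf : ∀ p, (adjf p).IsQF := fun p => (IsAtomic.rel _ _).isQF
  have eq_real : ∀ (V : Type u) (G : SimpleGraph V) (t : ι → V) p,
      Realizes G (eqf p) t ↔ t p.1 = t p.2 := by
    intro V G t p
    let := G.structure
    simp [eqf, Realizes]
  have adj_real : ∀ (V : Type u) (G : SimpleGraph V) (t : ι → V) p,
      Realizes G (adjf p) t ↔ G.Adj (t p.1) (t p.2) := by
    intro V G t p
    let := G.structure
    simp only [adjf, Realizes, Formula.realize_rel₂, Term.realize_var]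
    rfl
  -- The complete diagram of `Q`; there are finitely many patterns on a finite index type, so a
  -- property of patterns is a finite disjunction of diagrams.
  let diag (Q : Pattern ι) : Language.graph.Formula ι :=
    Formula.iInf fun p : ι × ι => lit (Q.1 p.1 p.2) (eqf p) ⊓ lit (Q.2 p.1 p.2) (adjf p)
  refine ⟨Formula.iSup fun Q : P => diag Q, ?_, ?_⟩
  · exact isQF_iSup _ fun Q => isQF_iInf _ fun p =>
      (lit_qf _ _ (eq_qf p)).inf (lit_qf _ _ (adj_qf p))
  · intro V G t
    let := G.structure
    have key : ∀ Q, Realizes G (diag Q) t ↔ pattern G t = Q := by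
      intro Q
      have h1 : Realizes G (diag Q) t ↔ ∀ p : ι × ι,
          Realizes G (lit (Q.1 p.1 p.2) (eqf p)) t ∧ Realizes G (lit (Q.2 p.1 p.2) (adjf p)) t := by
        simp only [diag, Realizes, Formula.realize_iInf, Formula.realize_inf]
      rw [h1]
      simp only [lit_real, eq_real, adj_real, pattern, Prod.ext_iff, funext_iff, eq_iff_iff]
      exact ⟨fun h => ⟨fun i j => (h (i, j)).1, fun i j => (h (i, j)).2⟩,
        fun h p => ⟨h.1 _ _, h.2 _ _⟩⟩
    have h2 : Realizes G (Formula.iSup fun Q : P => diag Q) t ↔ ∃ Q : P, Realizes G (diag Q) t := by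
      simp only [Realizes, Formula.realize_iSup]
    rw [h2]
    simp only [key]
    exact ⟨fun ⟨Q, hQ⟩ => hQ ▸ Q.2, fun h => ⟨⟨_, h⟩, rfl⟩⟩

/-- The existence of a tuple with a prescribed pattern over the parameters is expressed by an
existential formula. -/
lemma exists_isExistential_realizes_iff {α κ : Type v} [Finite α] [Finite κ]
    (P : Set (Pattern (α ⊕ κ))) :
    ∃ φ : Language.graph.Formula α, φ.IsExistential ∧
      ∀ (V : Type u) (G : SimpleGraph V) (a : α → V),
        Realizes G φ a ↔ ∃ y : κ → V, pattern G (Sum.elim a y) ∈ P := by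
  obtain ⟨θ, hθ, h⟩ := exists_isQF_realizes_iff.{u} P
  refine ⟨θ.iExs κ, isExistential_iExs hθ, fun V G a => ?_⟩
  let := G.structure
  have : Realizes G (θ.iExs κ) a ↔ ∃ y : κ → V, Realizes G θ (Sum.elim a y) := by
    simp only [Realizes, Formula.realize_iExs]
  rw [this]
  simp only [h]

lemma realize_isQF_of_isEmbeddingOn {V' V : Type u} {H : SimpleGraph V'} {G : SimpleGraph V}
    {α : Type*} {k : ℕ} {φ : Language.graph.BoundedFormula α k} (hφ : φ.IsQF) {S : Set V'}
    {h : V' → V} (hh : IsEmbeddingOn H G S h) {v : α → V'} {xs : Fin k → V'}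
    (hv : ∀ i, v i ∈ S) (hxs : ∀ i, xs i ∈ S) :
    @BoundedFormula.Realize _ _ G.structure _ _ φ (h ∘ v) (h ∘ xs) ↔
      @BoundedFormula.Realize _ _ H.structure _ _ φ v xs := by
  let iG := G.structure
  let iH := H.structure
  -- The language of graphs has no function symbols.
  have hterm : ∀ t : Language.graph.Term (α ⊕ Fin k), ∃ i, t = Term.var i := by
    rintro (i | ⟨f, -⟩)
    exacts [⟨i, rfl⟩, isEmptyElim f]
  have hel : ∀ i, Sum.elim v xs i ∈ S := by
    rintro (i | i)
    exacts [hv i, hxs i]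
  have hel' : ∀ i, Sum.elim (h ∘ v) (h ∘ xs) i = h (Sum.elim v xs i) := by
    rintro (i | i) <;> rfl
  induction hφ with
  | falsum => rfl
  | of_isAtomic ha =>
    cases ha with
    | equal t₁ t₂ =>
      obtain ⟨i, rfl⟩ := hterm t₁
      obtain ⟨j, rfl⟩ := hterm t₂
      simp only [realize_bdEqual, Term.realize_var, hel']
      exact ⟨fun e => hh.1 (hel i) (hel j) e, congrArg h⟩
    | rel R ts =>
      rename_i l
      rw [realize_rel, realize_rel]
      match l, R with
      | 2, .adj =>
        obtain ⟨i, hi⟩ := hterm (ts 0)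
        obtain ⟨j, hj⟩ := hterm (ts 1)
        change G.Adj ((ts 0).realize _) ((ts 1).realize _) ↔
          H.Adj ((ts 0).realize _) ((ts 1).realize _)
        simp only [hi, hj, Term.realize_var, hel']
        exact hh.2 _ (hel i) _ (hel j)
  | imp h₁ h₂ ih₁ ih₂ =>
    simp only [realize_imp, ih₁, ih₂]

/-- The truth of an existential formula is witnessed on a finite set of vertices. -/
lemma exists_finset_of_realize_isExistential {V' : Type u} {H : SimpleGraph V'}
    {α : Type*} {k : ℕ} {φ : Language.graph.BoundedFormula α k} (hφ : φ.IsExistential) :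
    ∀ {v : α → V'} {xs : Fin k → V'},
    @BoundedFormula.Realize _ _ H.structure _ _ φ v xs →
    ∃ Y : Finset V', ∀ (V : Type u) (G : SimpleGraph V) (h : V' → V),
      IsEmbeddingOn H G (Set.range v ∪ Set.range xs ∪ Y) h →
      @BoundedFormula.Realize _ _ G.structure _ _ φ (h ∘ v) (h ∘ xs) := by
  classical
  let iH := H.structure
  induction hφ with
  | of_isQF hqf =>
    intro v xs hr
    refine ⟨∅, fun V G h hh => (realize_isQF_of_isEmbeddingOn hqf hh ?_ ?_).2 hr⟩
    · exact fun i => Or.inl (Or.inl ⟨i, rfl⟩)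
    · exact fun i => Or.inl (Or.inr ⟨i, rfl⟩)
  | ex hφ ih =>
    intro v xs hr
    rw [realize_ex] at hr
    obtain ⟨x, hx⟩ := hr
    obtain ⟨Y, hY⟩ := ih hx
    refine ⟨insert x Y, fun V G h hh => ?_⟩
    let := G.structure
    rw [realize_ex]
    refine ⟨h x, ?_⟩
    rw [← Fin.comp_snoc]
    refine hY V G h (hh.mono ?_)
    rintro y ((⟨i, rfl⟩ | ⟨i, rfl⟩) | hy)
    · exact Or.inl (Or.inl ⟨i, rfl⟩)
    · refine Fin.lastCases ?_ (fun i => ?_) i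
      · right; simp
      · left; right; simp
    · right; simp [hy]

end Formulas

/-! ### Existential completeness and algebraic closure without formulas. -/

section Retractions

open Language BoundedFormula

/-- Every finite set of vertices of a graph of `𝒢_C` above `G` can be pulled back into `G`,
fixing the vertices of `G`. -/
def HasFiniteRetractions {W : Type v} (C : SimpleGraph W) {V : Type u} (G : SimpleGraph V) : Prop :=
  ∀ (V' : Type u) (H : SimpleGraph V') (e : G ↪g H), IsCountableFree C H →
    ∀ S : Set V', S.Finite → ∃ h : V' → V, IsEmbeddingOn H G S h ∧ ∀ a, e a ∈ S → h (e a) = a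

lemma _root_.Set.Finite.exists_fin_range_eq {α : Type*} {S : Set α} (hS : S.Finite) :
    ∃ (k : ℕ) (y : Fin k → α), Set.range y = S := by
  obtain ⟨k, y, -, hy⟩ := hS.fin_param
  exact ⟨k, y, hy⟩

/-- That some tuple has the pattern of `S` over the part of `S` lying in `G` is an existential
statement true in `H`, hence in `G`; a tuple realizing it is the retraction. -/
lemma IsExistentiallyComplete.hasFiniteRetractions {W : Type v} {C : SimpleGraph W} {V : Type u}
    {G : SimpleGraph V} (hG : IsExistentiallyComplete C G) : HasFiniteRetractions C G := by
  intro V' H e hH S hS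
  rcases isEmpty_or_nonempty V' with hV' | ⟨⟨x₀⟩⟩
  · exact ⟨fun x => isEmptyElim x, ⟨fun x => isEmptyElim x, fun x => isEmptyElim x⟩,
      fun a => isEmptyElim (e a)⟩
  -- Adding `x₀` makes the tuple nonempty, so that a realization of it shows `V` nonempty.
  obtain ⟨k, y, hy⟩ := (hS.insert x₀).exists_fin_range_eq
  obtain ⟨m, a, ha⟩ := ((hS.preimage e.injective.injOn) : (e ⁻¹' S).Finite).exists_fin_range_eq
  obtain ⟨φ, hφ, hreal⟩ := exists_isExistential_realizes_iff.{u}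
    ({pattern H (Sum.elim (fun i => e (a i)) y)} : Set (Pattern (Fin m ⊕ Fin k)))
  have h1 : Realizes G φ a := hG.2 V' H e hH m φ a hφ ((hreal _ _ _).2 ⟨y, rfl⟩)
  obtain ⟨y', hy'⟩ := (hreal _ _ _).1 h1
  have : ∃ i, y i = x₀ := by
    have : x₀ ∈ Set.range y := hy ▸ Set.mem_insert _ _
    exact this
  obtain ⟨i₀, -⟩ := this
  have : Nonempty V := ⟨y' i₀⟩
  obtain ⟨h, hh, hval⟩ := exists_isEmbeddingOn_of_pattern_eq hy'
  refine ⟨h, hh.mono ?_, fun b hb => ?_⟩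
  · intro x hx
    have : x ∈ Set.range y := hy ▸ Set.mem_insert_of_mem _ hx
    obtain ⟨i, rfl⟩ := this
    exact ⟨Sum.inr i, rfl⟩
  · have : b ∈ Set.range a := ha ▸ hb
    obtain ⟨i, rfl⟩ := this
    exact hval (Sum.inl i)

lemma HasFiniteRetractions.isExistentiallyComplete {W : Type v} {C : SimpleGraph W} {V : Type u}
    {G : SimpleGraph V} (hG : HasFiniteRetractions C G) (hf : IsCountableFree C G) :
    IsExistentiallyComplete C G := by
  refine ⟨hf, fun V' H e hH m φ a hφ hr => ?_⟩
  obtain ⟨Y, hY⟩ := exists_finset_of_realize_isExistential hφ hr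
  obtain ⟨h, hh, hfix⟩ := hG V' H e hH _
    (((Set.finite_range fun i => e (a i)).union (Set.finite_range (default : Fin 0 → V'))).union
      Y.finite_toSet)
  have := hY V G h hh
  have e1 : (h ∘ fun i => e (a i)) = a := funext fun i => hfix _ (Or.inl (Or.inl ⟨i, rfl⟩))
  rw [e1, Subsingleton.elim (h ∘ default) default] at this
  exact this

lemma IsExistentiallyComplete.nonempty {n : ℕ} {V : Type u} {G : SimpleGraph V}
    (hG : IsExistentiallyComplete (cliqueWithTriangle n) G) : Nonempty V := by
  by_contra hne
  rw [not_nonempty_iff] at hne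
  have hfree : (cliqueWithTriangle n).Free (⊥ : SimpleGraph PUnit.{u + 1}) := by
    rintro ⟨c⟩
    have := c.injective (Subsingleton.elim (c.toHom ⟨0, by omega⟩) (c.toHom ⟨1, by omega⟩))
    simp at this
  obtain ⟨h, -⟩ := hG.hasFiniteRetractions PUnit.{u + 1} ⊥
    ⟨⟨fun x => isEmptyElim x, fun x => isEmptyElim x⟩, fun {x} => isEmptyElim x⟩
    ⟨inferInstance, hfree⟩ ∅ Set.finite_empty
  exact isEmptyElim (h PUnit.unit)

variable {V : Type u} {G : SimpleGraph V} {A : Set V} {b : V}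

/-- The formula says that `x` and the parameters in `S ∩ A` extend to a tuple with the pattern of
`S`; its solutions are images of `b` under embeddings of `S` fixing `S ∩ A`. With
`exists_finite_of_mem_acl`, this turns algebraicity into a statement about finite sets. -/
lemma mem_acl_of_finite {S : Set V} (hS : S.Finite)
    (hfin : {x | ∃ h : V → V, IsEmbeddingOn G G S h ∧ (∀ a ∈ S, a ∈ A → h a = a) ∧
      h b = x}.Finite) : b ∈ acl G A := by
  obtain ⟨k, y, hy⟩ := hS.exists_fin_range_eq
  obtain ⟨m, a, ha⟩ := (hS.inter_of_left A).exists_fin_range_eq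
  obtain ⟨φ, hφ, hreal⟩ := exists_isExistential_realizes_iff.{u}
    ({pattern G (Sum.elim (Fin.cons b a : Fin (m + 1) → V) y)} :
      Set (Pattern (Fin (m + 1) ⊕ Fin k)))
  have ha' : ∀ i, a i ∈ S ∩ A := fun i => ha ▸ ⟨i, rfl⟩
  refine ⟨m, φ, a, hφ, fun i => (ha' i).2, hfin.subset ?_, (hreal _ _ _).2 ⟨y, rfl⟩⟩
  intro x hx
  obtain ⟨y', hy'⟩ := (hreal _ _ _).1 hx
  have : Nonempty V := ⟨b⟩
  obtain ⟨h, hh, hval⟩ := exists_isEmbeddingOn_of_pattern_eq hy'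
  refine ⟨h, hh.mono ?_, fun c hc hcA => ?_, hval (Sum.inl 0)⟩
  · intro x hx
    rw [← hy] at hx
    obtain ⟨i, rfl⟩ := hx
    exact ⟨Sum.inr i, rfl⟩
  · have : c ∈ Set.range a := ha ▸ ⟨hc, hcA⟩
    obtain ⟨i, rfl⟩ := this
    exact hval (Sum.inl i.succ)

lemma exists_finite_of_mem_acl (hb : b ∈ acl G A) : ∃ S : Set V, S.Finite ∧ b ∈ S ∧
    {x | ∃ h : V → V, IsEmbeddingOn G G S h ∧ (∀ a ∈ S, a ∈ A → h a = a) ∧ h b = x}.Finite := by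
  obtain ⟨m, φ, a, hφ, haA, hfin, hr⟩ := hb
  obtain ⟨Y, hY⟩ := exists_finset_of_realize_isExistential hφ hr
  refine ⟨_, ((Set.finite_range (Fin.cons b a : Fin (m + 1) → V)).union
    (Set.finite_range (default : Fin 0 → V))).union Y.finite_toSet,
    Or.inl (Or.inl ⟨0, rfl⟩), hfin.subset ?_⟩
  rintro _ ⟨h, hh, hfix, rfl⟩
  have := hY V G h hh
  have e1 : (h ∘ (Fin.cons b a : Fin (m + 1) → V)) = Fin.cons (h b) a := by
    funext i
    refine Fin.cases rfl (fun i => ?_) i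
    exact hfix _ (Or.inl (Or.inl ⟨i.succ, rfl⟩)) (haA i)
  rw [e1, Subsingleton.elim (h ∘ default) default] at this
  exact this

lemma subset_acl : A ⊆ acl G A := by
  intro b hb
  refine mem_acl_of_finite (Set.finite_singleton b) ((Set.finite_singleton b).subset ?_)
  rintro x ⟨h, -, hfix, rfl⟩
  exact hfix b rfl hb

lemma acl_mono {B : Set V} (hAB : A ⊆ B) : acl G A ⊆ acl G B := by
  rintro b ⟨m, φ, a, hφ, haA, h⟩
  exact ⟨m, φ, a, hφ, fun i => hAB (haA i), h⟩

end Retractions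

/-! ### Forbidding `C` in terms of cliques and triangles. -/

section Cliques

variable {V : Type*} {G : SimpleGraph V} {n : ℕ}

/-- No triangle meets a clique of order `n` in exactly one vertex. -/
def CliqueTriangleFree (n : ℕ) (G : SimpleGraph V) : Prop :=
  ∀ Q : Finset V, G.IsClique (Q : Set V) → Q.card = n → ∀ v ∈ Q, ∀ x y, G.Adj v x → G.Adj v y →
    G.Adj x y → x ∈ Q ∨ y ∈ Q

lemma free_cliqueWithTriangle_iff (hn : 1 ≤ n) :
    (cliqueWithTriangle n).Free G ↔ CliqueTriangleFree n G := by
  classical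
  constructor
  · intro hfree Q hQ hcard v hv x y hvx hvy hxy
    by_contra! hcon
    obtain ⟨m, rfl⟩ : ∃ m, n = m + 1 := ⟨n - 1, by omega⟩
    have hcard' : (Q.erase v).card = m := by rw [Finset.card_erase_of_mem hv, hcard]; rfl
    let g := (Q.erase v).equivFin.symm
    rw [hcard'] at g
    have hgQ : ∀ i, (g i : V) ∈ Q := fun i => Finset.mem_of_mem_erase (g i).2
    have hgv : ∀ i, (g i : V) ≠ v := fun i => Finset.ne_of_mem_erase (g i).2
    have hg : ∀ i j, (g i : V) = g j → i = j := fun i j h => g.injective (Subtype.ext h)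
    have hgx : ∀ i, (g i : V) ≠ x := fun i h => hcon.1 (h ▸ hgQ i)
    have hgy : ∀ i, (g i : V) ≠ y := fun i h => hcon.2 (h ▸ hgQ i)
    -- With `n = m + 1`, the shared vertex `n - 1` of `C` is sent to `v`, the smaller indices to the
    -- rest of `Q`, and the last two to `x` and `y`.
    let f : Fin (m + 3) → V := Fin.append (fun i => (g i : V)) ![v, x, y]
    have hf : Function.Injective f := by
      intro i j
      refine Fin.addCases (fun i => ?_) (fun i => ?_) i <;>
        refine Fin.addCases (fun j => ?_) (fun j => ?_) j
      · simp only [f, Fin.append_left]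
        intro h
        rw [hg i j h]
      · simp only [f, Fin.append_left, Fin.append_right]
        fin_cases j
        · exact fun h => absurd h (hgv i)
        · exact fun h => absurd h (hgx i)
        · exact fun h => absurd h (hgy i)
      · simp only [f, Fin.append_left, Fin.append_right]
        fin_cases i
        · exact fun h => absurd h.symm (hgv j)
        · exact fun h => absurd h.symm (hgx j)
        · exact fun h => absurd h.symm (hgy j)
      · simp only [f, Fin.append_right]
        fin_cases i <;> fin_cases j <;>
          simp [hvx.ne, hvy.ne, hxy.ne, hvx.ne.symm, hvy.ne.symm, hxy.ne.symm]
    have hlow : ∀ i : Fin (m + 3), i.val < m + 1 → f i ∈ Q := by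
      intro i
      refine Fin.addCases (fun i => ?_) (fun i => ?_) i
      · simp only [f, Fin.append_left]
        exact fun _ => hgQ i
      · simp only [f, Fin.append_right]
        fin_cases i
        · exact fun _ => hv
        · intro h; simp at h
        · intro h; simp at h
    have hhigh : ∀ i : Fin (m + 3), m ≤ i.val → f i = v ∨ f i = x ∨ f i = y := by
      intro i
      refine Fin.addCases (fun i => ?_) (fun i => ?_) i
      · intro h
        have := i.2
        simp at h
        omega
      · simp only [f, Fin.append_right]
        fin_cases i <;> simp
    refine hfree ⟨⟨⟨f, ?_⟩, hf⟩⟩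
    rintro i j ⟨hne, ⟨hi, hj⟩ | ⟨hi, hj⟩⟩
    · exact hQ (hlow i hi) (hlow j hj) (fun h => hne (hf h))
    · have hfne : f i ≠ f j := fun h => hne (hf h)
      rcases hhigh i (by omega) with h1 | h1 | h1 <;> rcases hhigh j (by omega) with h2 | h2 | h2 <;>
        rw [h1, h2] at hfne ⊢ <;>
        first | exact absurd rfl hfne | assumption | (apply SimpleGraph.Adj.symm; assumption)
  · rintro h ⟨c⟩
    have hinj := c.injective
    have hadj : ∀ i j, (cliqueWithTriangle n).Adj i j → G.Adj (c i) (c j) :=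
      fun i j hij => c.toHom.map_adj hij
    let Q : Finset V := Finset.univ.image fun i : Fin n => c (i.castLE (by omega))
    have hmem : ∀ i : Fin (n + 2), c i ∈ Q → i.val < n := by
      intro i hi
      obtain ⟨j, -, hj⟩ := Finset.mem_image.1 hi
      rw [← hinj hj]
      exact j.2
    have h3 := h Q ?_ ?_ (c ⟨n - 1, by omega⟩) ?_ (c ⟨n, by omega⟩) (c ⟨n + 1, by omega⟩) ?_ ?_ ?_
    · rcases h3 with h3 | h3
      · have := hmem _ h3; simp at this
      · have := hmem _ h3; simp at this
    · intro a ha b hb hab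
      simp only [Q, Finset.coe_image, Finset.coe_univ, Set.image_univ, Set.mem_range] at ha hb
      obtain ⟨i, rfl⟩ := ha
      obtain ⟨j, rfl⟩ := hb
      exact hadj _ _ ⟨fun e => hab (by rw [e]), Or.inl ⟨i.2, j.2⟩⟩
    · rw [Finset.card_image_of_injective, Finset.card_univ, Fintype.card_fin]
      intro i j hij
      have := hinj hij
      exact Fin.castLE_injective _ this
    · exact Finset.mem_image.2 ⟨⟨n - 1, by omega⟩, Finset.mem_univ _, rfl⟩
    · refine hadj _ _ ⟨?_, Or.inr ⟨?_, ?_⟩⟩ <;> simp only [ne_eq, Fin.mk.injEq] <;> omega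
    · refine hadj _ _ ⟨?_, Or.inr ⟨?_, ?_⟩⟩ <;> simp only [ne_eq, Fin.mk.injEq] <;> omega
    · refine hadj _ _ ⟨?_, Or.inr ⟨?_, ?_⟩⟩ <;> simp only [ne_eq, Fin.mk.injEq] <;> omega

end Cliques

/-! ### How `n`-cliques meet in a `C`-free graph, and the shape of `a*`. -/

section Clusters

variable {V : Type*} {G : SimpleGraph V} {n : ℕ}

/-- `Q` is a clique of order `n` that no other such clique meets. -/
def IsIsolatedClique (G : SimpleGraph V) (n : ℕ) (Q : Finset V) : Prop :=
  G.IsNClique n Q ∧ ∀ R : Finset V, G.IsNClique n R → ∀ x ∈ R, x ∈ Q → R = Q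

/-- `B` is a clique of order `n - 1` contained in at least two cliques of order `n`. -/
def IsKernel (G : SimpleGraph V) (n : ℕ) (B : Finset V) : Prop :=
  G.IsClique (B : Set V) ∧ B.card + 1 = n ∧
    ∃ x y : V, x ≠ y ∧ (∀ v ∈ B, G.Adj x v) ∧ (∀ v ∈ B, G.Adj y v)

lemma isSpecial_iff {B : Finset V} :
    IsSpecial G n B ↔ IsIsolatedClique G n B ∨ IsKernel G n B := by
  constructor
  · rintro ⟨hB, ⟨hc, h⟩ | ⟨hc, h⟩⟩
    · refine Or.inl ⟨⟨hB, hc⟩, fun R hR x hx hxB => ?_⟩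
      by_contra hne
      exact h ⟨R, hR.card_eq, hne, ⟨x, hx, hxB⟩, hR.isClique⟩
    · exact Or.inr ⟨hB, hc, h⟩
  · rintro (⟨hB, h⟩ | ⟨hB, hc, h⟩)
    · refine ⟨hB.isClique, Or.inl ⟨hB.card_eq, ?_⟩⟩
      rintro ⟨R, hR, hne, ⟨x, hx, hxB⟩, hR'⟩
      exact hne (h R ⟨hR', hR⟩ x hx hxB)
    · exact ⟨hB, Or.inr ⟨hc, h⟩⟩

lemma notMem_of_forall_adj {B : Finset V} {x : V} (h : ∀ v ∈ B, G.Adj x v) : x ∉ B :=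
  fun hx => (h x hx).ne rfl

lemma isNClique_insert_of_forall_adj [DecidableEq V] {B : Finset V} {x : V}
    (hB : G.IsClique (B : Set V)) (hc : B.card + 1 = n) (h : ∀ v ∈ B, G.Adj x v) :
    G.IsNClique n (insert x B) := by
  refine ⟨?_, by rw [Finset.card_insert_of_notMem (notMem_of_forall_adj h), hc]⟩
  rw [Finset.coe_insert]
  exact hB.insert fun b hb _ => h b hb

lemma IsKernel.exists_isNClique {B : Finset V} {a : V} (hB : IsKernel G n B)
    (ha : G.IsClique (insert a (B : Set V))) : ∃ Q : Finset V, G.IsNClique n Q ∧ a ∈ Q ∧ B ⊆ Q := by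
  classical
  obtain ⟨hcl, hc, x, y, -, hx, -⟩ := hB
  by_cases haB : a ∈ B
  · exact ⟨insert x B, isNClique_insert_of_forall_adj hcl hc hx, Finset.mem_insert_of_mem haB,
      Finset.subset_insert _ _⟩
  · refine ⟨insert a B, ⟨by rwa [Finset.coe_insert], ?_⟩, Finset.mem_insert_self _ _,
      Finset.subset_insert _ _⟩
    rw [Finset.card_insert_of_notMem haB, hc]

lemma IsKernel.isNClique_succ [DecidableEq V] {B : Finset V} {p q : V} (hB : IsKernel G n B)
    (hp : ∀ v ∈ B, G.Adj p v) (hq : ∀ v ∈ B, G.Adj q v) (hpq : G.Adj p q) :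
    G.IsNClique (n + 1) (insert p (insert q B)) := by
  have hQ := isNClique_insert_of_forall_adj hB.1 hB.2.1 hq
  refine isNClique_insert_of_forall_adj hQ.isClique (by rw [hQ.card_eq]) fun v hv => ?_
  rcases Finset.mem_insert.1 hv with rfl | hv
  exacts [hpq, hp v hv]

lemma _root_.SimpleGraph.IsNClique.erase_of_succ [DecidableEq V] {P : Finset V} {u : V}
    (hP : G.IsNClique (n + 1) P) (hu : u ∈ P) : G.IsNClique n (P.erase u) :=
  ⟨hP.isClique.subset (by simp),
    by rw [Finset.card_erase_of_mem hu, hP.card_eq]; rfl⟩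

/-- A finset with at least three elements has an element avoiding two given ones. -/
lemma _root_.Finset.exists_mem_notMem_pair {Q : Finset V} (hQ : 3 ≤ Q.card) (a b : V) :
    ∃ w ∈ Q, w ≠ a ∧ w ≠ b := by
  classical
  obtain ⟨w, hw, hw'⟩ := Finset.exists_mem_notMem_of_card_lt_card
    (s := ({a, b} : Finset V)) (t := Q) (lt_of_le_of_lt Finset.card_le_two (by omega))
  simp only [Finset.mem_insert, Finset.mem_singleton, not_or] at hw'
  exact ⟨w, hw, hw'⟩

/-- Otherwise adding `a` and deleting a vertex of `Q` gives another `n`-clique meeting `Q`. -/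
lemma IsIsolatedClique.mem_of_isClique_insert {Q : Finset V} {a : V} (hn : 3 ≤ n)
    (hQ : IsIsolatedClique G n Q) (ha : G.IsClique (insert a (Q : Set V))) : a ∈ Q := by
  classical
  by_contra haQ
  have hP : G.IsNClique (n + 1) (insert a Q) :=
    ⟨by rwa [Finset.coe_insert], by rw [Finset.card_insert_of_notMem haQ, hQ.1.card_eq]⟩
  obtain ⟨u, hu, -⟩ := Finset.exists_mem_notMem_pair (hQ.1.card_eq.symm ▸ hn) a a
  obtain ⟨w, hw, hwu, -⟩ := Finset.exists_mem_notMem_pair (hQ.1.card_eq.symm ▸ hn) u a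
  have := hQ.2 _ (hP.erase_of_succ (Finset.mem_insert_of_mem hu)) w
    (Finset.mem_erase.2 ⟨hwu, Finset.mem_insert_of_mem hw⟩) hw
  rw [← this] at hu
  simp at hu

/-- Both extensions of the kernel to an `n`-clique meet `Q`, so both equal `Q`, although they
differ. -/
lemma IsIsolatedClique.not_isKernel_subset {Q B : Finset V} (hn : 3 ≤ n)
    (hQ : IsIsolatedClique G n Q) (hB : IsKernel G n B) : ¬ B ⊆ Q := by
  classical
  intro hBQ
  obtain ⟨hcl, hc, x, y, hxy, hx, hy⟩ := hB
  obtain ⟨b, hb⟩ : B.Nonempty := Finset.card_pos.1 (by omega)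
  have h1 := hQ.2 _ (isNClique_insert_of_forall_adj hcl hc hx) b (Finset.mem_insert_of_mem hb)
    (hBQ hb)
  have h2 := hQ.2 _ (isNClique_insert_of_forall_adj hcl hc hy) b (Finset.mem_insert_of_mem hb)
    (hBQ hb)
  have : x ∈ insert y B := by rw [h2, ← h1]; exact Finset.mem_insert_self _ _
  rcases Finset.mem_insert.1 this with h | h
  exacts [hxy h, notMem_of_forall_adj hx h]

lemma IsIsolatedClique.star_eq {Q : Finset V} {a : V} (hn : 3 ≤ n)
    (hQ : IsIsolatedClique G n Q) (ha : a ∈ Q) : star G n a = Q := by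
  ext b
  constructor
  · rintro ⟨B, hB, hclq, hb⟩
    rcases isSpecial_iff.1 hB with hB | hB
    · rw [← hQ.2 B hB.1 a (hB.mem_of_isClique_insert hn hclq) ha]
      exact hb
    · obtain ⟨R, hR, haR, hBR⟩ := hB.exists_isNClique hclq
      rw [hQ.2 R hR a haR ha] at hBR
      exact absurd hBR (hQ.not_isKernel_subset hn hB)
  · intro hb
    exact ⟨Q, isSpecial_iff.2 (Or.inl hQ),
      by rw [Set.insert_eq_of_mem (by exact ha)]; exact hQ.1.1, hb⟩

/-- Delete from `P` two vertices other than `c`; they witness that the rest is a kernel. -/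
lemma exists_isKernel_of_mem {P : Finset V} {c : V} (hn : 3 ≤ n) (hP : G.IsNClique (n + 1) P)
    (hc : c ∈ P) : ∃ B ⊆ P, c ∈ B ∧ IsKernel G n B := by
  classical
  obtain ⟨u, hu, huc, -⟩ := Finset.exists_mem_notMem_pair (Q := P) (by rw [hP.card_eq]; omega) c c
  obtain ⟨w, hw, hwc, hwu⟩ :=
    Finset.exists_mem_notMem_pair (Q := P) (by rw [hP.card_eq]; omega) c u
  have hsub : (P.erase u).erase w ⊆ P := (Finset.erase_subset _ _).trans (Finset.erase_subset _ _)
  refine ⟨(P.erase u).erase w, hsub, by simp [hc, huc.symm, hwc.symm],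
    hP.isClique.subset (by exact_mod_cast hsub), ?_, u, w, hwu.symm, ?_, ?_⟩
  · rw [Finset.card_erase_of_mem (by simp [hw, hwu]), Finset.card_erase_of_mem hu, hP.card_eq]
    omega
  · intro v hv
    simp only [Finset.mem_erase] at hv
    exact hP.isClique hu hv.2.2 hv.2.1.symm
  · intro v hv
    simp only [Finset.mem_erase] at hv
    exact hP.isClique hw hv.2.2 hv.1.symm

namespace CliqueTriangleFree

variable (hG : CliqueTriangleFree n G)
include hG

/-- Two distinct vertices outside `Q` would form with `v` a triangle meeting `Q` only in `v`. This
is the form in which freeness is mostly used. -/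
lemma eq_of_mem_sdiff {Q R : Finset V} {v z₁ z₂ : V} (hQ : G.IsNClique n Q)
    (hR : G.IsClique (R : Set V)) (hvQ : v ∈ Q) (hvR : v ∈ R) (h₁ : z₁ ∈ R) (h₂ : z₂ ∈ R)
    (h₁' : z₁ ∉ Q) (h₂' : z₂ ∉ Q) : z₁ = z₂ := by
  by_contra hne
  rcases hG Q hQ.1 hQ.2 v hvQ z₁ z₂ (hR hvR h₁ (by rintro rfl; exact h₁' hvQ))
    (hR hvR h₂ (by rintro rfl; exact h₂' hvQ)) (hR h₁ h₂ hne) with h | h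
  exacts [h₁' h, h₂' h]

lemma subset_of_isNClique_succ {P R : Finset V} {v : V} (hn : 3 ≤ n)
    (hP : G.IsNClique (n + 1) P) (hR : G.IsClique (R : Set V)) (hRc : 3 ≤ R.card) (hvP : v ∈ P)
    (hvR : v ∈ R) : R ⊆ P := by
  classical
  intro z hz
  by_contra hzP
  obtain ⟨w, hw, hwv, hwz⟩ := Finset.exists_mem_notMem_pair hRc v z
  -- Delete `w` from `P` if it is there, otherwise any vertex but `v`: the remaining `n`-clique
  -- contains `v` and misses both `w` and `z`.
  obtain ⟨u, hu, huv, huw⟩ : ∃ u ∈ P, u ≠ v ∧ w ∉ P.erase u := by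
    by_cases hwP : w ∈ P
    · exact ⟨w, hwP, hwv, by simp⟩
    · obtain ⟨u, hu, huv, -⟩ :=
        Finset.exists_mem_notMem_pair (Q := P) (by rw [hP.card_eq]; omega) v v
      exact ⟨u, hu, huv, fun h => hwP (Finset.mem_of_mem_erase h)⟩
  exact hwz (hG.eq_of_mem_sdiff (hP.erase_of_succ hu) hR (Finset.mem_erase.2 ⟨huv.symm, hvP⟩) hvR
    hw hz huw fun h => hzP (Finset.mem_of_mem_erase h))

/-- If `R` missed a vertex of `B`, it would have two vertices outside `B`. Neither `B ∪ {p}` nor `B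
∪ {q}` can miss both, so these would be `p` and `q`, which are not adjacent. -/
lemma isKernel_subset {B R : Finset V} {v p q : V} (hn : 3 ≤ n) (hB : IsKernel G n B) (hpq : p ≠ q)
    (hp : ∀ v ∈ B, G.Adj p v) (hq : ∀ v ∈ B, G.Adj q v) (hnadj : ¬ G.Adj p q)
    (hR : G.IsNClique n R) (hvR : v ∈ R) (hvB : v ∈ B) : B ⊆ R := by
  classical
  intro u hu
  by_contra huR
  have hcard : 1 < (R \ B).card := by
    have h1 : R ∩ B ⊆ B.erase u := by
      intro x hx
      rw [Finset.mem_inter] at hx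
      exact Finset.mem_erase.2 ⟨by rintro rfl; exact huR hx.1, hx.2⟩
    have h2 := Finset.card_le_card h1
    rw [Finset.card_erase_of_mem hu] at h2
    have h3 := Finset.card_sdiff_add_card_inter R B
    have h4 := hR.card_eq
    have h5 := hB.2.1
    omega
  obtain ⟨z₁, z₂, h₁, h₂, hne⟩ := Finset.one_lt_card_iff.1 hcard
  rw [Finset.mem_sdiff] at h₁ h₂
  have key : ∀ x, (∀ v ∈ B, G.Adj x v) → z₁ = x ∨ z₂ = x := by
    intro x hx
    by_contra! hcon
    refine hne (hG.eq_of_mem_sdiff (isNClique_insert_of_forall_adj hB.1 hB.2.1 hx) hR.1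
      (Finset.mem_insert_of_mem hvB) hvR h₁.1 h₂.1 ?_ ?_)
    · simp [hcon.1, h₁.2]
    · simp [hcon.2, h₂.2]
  have hadj : G.Adj z₁ z₂ := hR.1 h₁.1 h₂.1 hne
  rcases key p hp with rfl | rfl <;> rcases key q hq with rfl | rfl
  exacts [hpq rfl, hnadj hadj, hnadj hadj.symm, hpq rfl]

/-- Each of the two cliques has exactly one vertex outside the other, and these two vertices extend
the intersection. -/
lemma isKernel_inter [DecidableEq V] {Q R : Finset V} {v : V} (hQ : G.IsNClique n Q)
    (hR : G.IsNClique n R) (hne : R ≠ Q) (hvQ : v ∈ Q) (hvR : v ∈ R) : IsKernel G n (Q ∩ R) := by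
  obtain ⟨y, hy⟩ : (R \ Q).Nonempty := by
    rw [Finset.sdiff_nonempty]
    exact fun h => hne (Finset.eq_of_subset_of_card_le h (by rw [hQ.card_eq, hR.card_eq]))
  obtain ⟨x, hx⟩ : (Q \ R).Nonempty := by
    rw [Finset.sdiff_nonempty]
    exact fun h => hne.symm (Finset.eq_of_subset_of_card_le h (by rw [hQ.card_eq, hR.card_eq]))
  have hcard : (Q \ R).card = 1 := by
    refine le_antisymm (Finset.card_le_one.2 fun a ha b hb => ?_) (Finset.card_pos.2 ⟨x, hx⟩)
    rw [Finset.mem_sdiff] at ha hb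
    exact hG.eq_of_mem_sdiff hR hQ.1 hvR hvQ ha.1 hb.1 ha.2 hb.2
  rw [Finset.mem_sdiff] at hx hy
  refine ⟨hQ.1.subset (by simp), ?_, x, y, ?_, ?_, ?_⟩
  · have := Finset.card_sdiff_add_card_inter Q R
    have := hQ.card_eq
    omega
  · rintro rfl
    exact hx.2 hy.1
  · intro b hb
    rw [Finset.mem_inter] at hb
    exact hQ.1 hx.1 hb.1 (by rintro rfl; exact hx.2 hb.2)
  · intro b hb
    rw [Finset.mem_inter] at hb
    exact hR.1 hy.1 hb.2 (by rintro rfl; exact hy.2 hb.1)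

/-- A special set forming a clique with `a` lies in an `n`-clique through `a`, which `P` absorbs;
conversely the kernels inside `P` cover it. -/
lemma star_eq_of_isNClique_succ {P : Finset V} {a : V} (hn : 3 ≤ n)
    (hP : G.IsNClique (n + 1) P) (ha : a ∈ P) : star G n a = P := by
  ext b
  constructor
  · rintro ⟨B, hB, hclq, hb⟩
    rcases isSpecial_iff.1 hB with hB | hB
    · exact hG.subset_of_isNClique_succ hn hP hB.1.1 (by rw [hB.1.card_eq]; exact hn) ha
        (hB.mem_of_isClique_insert hn hclq) hb
    · obtain ⟨R, hR, haR, hBR⟩ := hB.exists_isNClique hclq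
      exact hG.subset_of_isNClique_succ hn hP hR.1 (by rw [hR.card_eq]; exact hn) ha haR (hBR hb)
  · intro hb
    obtain ⟨B, hBP, hbB, hB⟩ := exists_isKernel_of_mem hn hP (Finset.mem_coe.1 hb)
    refine ⟨B, isSpecial_iff.2 (Or.inr hB), hP.1.subset ?_, hbB⟩
    exact Set.insert_subset ha (by exact_mod_cast hBP)

/-- Since `a` is in no `(n + 1)`-clique, `p` and `q` are non-adjacent, and `B` lies in every
`n`-clique meeting it. A competing kernel `D` lies with `B` in one `n`-clique, so it meets `B` as
`2(n - 1) > n`; then `B` is in both extensions of `D`, hence in `D`. -/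
lemma star_eq_of_isKernel {B : Finset V} {a : V} (hn : 3 ≤ n) (hB : IsKernel G n B)
    (ha : G.IsClique (insert a (B : Set V)))
    (hno : ∀ P : Finset V, G.IsNClique (n + 1) P → a ∉ P) : star G n a = B := by
  classical
  obtain ⟨hcl, hc, p, q, hpq, hp, hq⟩ := id hB
  obtain ⟨Q, hQ, haQ, hBQ⟩ := hB.exists_isNClique ha
  have hnadj : ¬ G.Adj p q := by
    intro hadj
    have hP := hB.isNClique_succ hp hq hadj
    obtain ⟨b, hb⟩ : B.Nonempty := Finset.card_pos.1 (by omega)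
    refine hno _ hP (hG.subset_of_isNClique_succ hn hP hQ.1 (by rw [hQ.card_eq]; exact hn)
      (v := b) ?_ (hBQ hb) haQ)
    exact Finset.mem_insert_of_mem (Finset.mem_insert_of_mem hb)
  ext b
  refine ⟨?_, fun hb => ⟨B, isSpecial_iff.2 (Or.inr hB), ha, hb⟩⟩
  rintro ⟨D, hD, hclq, hb⟩
  rcases isSpecial_iff.1 hD with hD | hD
  · have h := hD.2 Q hQ a haQ (hD.mem_of_isClique_insert hn hclq)
    exact absurd (h ▸ hBQ) (hD.not_isKernel_subset hn hB)
  · obtain ⟨R, hR, haR, hDR⟩ := hD.exists_isNClique hclq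
    obtain ⟨v, hvB, hvR⟩ : ∃ v ∈ B, v ∈ R := by
      by_contra! hcon
      obtain ⟨z₁, z₂, h₁, h₂, hne⟩ := Finset.one_lt_card_iff.1 (show 1 < B.card by omega)
      exact hne (hG.eq_of_mem_sdiff hR hQ.1 haR haQ (hBQ h₁) (hBQ h₂) (hcon _ h₁) (hcon _ h₂))
    have hBR := hG.isKernel_subset hn hB hpq hp hq hnadj hR hvR hvB
    obtain ⟨w, hw⟩ : (B ∩ D).Nonempty := by
      have h1 := Finset.card_le_card (Finset.union_subset hBR hDR)
      have h2 := Finset.card_union_add_card_inter B D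
      have h3 := hD.2.1
      have h4 := hR.card_eq
      exact Finset.card_pos.1 (by omega)
    rw [Finset.mem_inter] at hw
    obtain ⟨hDcl, hDc, p', q', hpq', hp', hq'⟩ := hD
    have h1 := hG.isKernel_subset hn hB hpq hp hq hnadj
      (isNClique_insert_of_forall_adj hDcl hDc hp') (Finset.mem_insert_of_mem hw.2) hw.1
    have h2 := hG.isKernel_subset hn hB hpq hp hq hnadj
      (isNClique_insert_of_forall_adj hDcl hDc hq') (Finset.mem_insert_of_mem hw.2) hw.1
    have hBD : B ⊆ D := by
      intro x hx
      rcases Finset.mem_insert.1 (h1 hx) with e1 | h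
      · rcases Finset.mem_insert.1 (h2 hx) with e2 | h
        · exact absurd (e1.symm.trans e2) hpq'
        · exact h
      · exact h
    rw [Finset.eq_of_subset_of_card_le hBD (by omega)]
    exact hb

/-- The possible shapes of `a*`. -/
lemma star_cases (hn : 3 ≤ n) (a : V) :
    (∃ P : Finset V, G.IsNClique (n + 1) P ∧ a ∈ P ∧ star G n a = P) ∨
    (∃ B : Finset V, IsKernel G n B ∧ G.IsClique (insert a (B : Set V)) ∧
      (∀ P : Finset V, G.IsNClique (n + 1) P → a ∉ P) ∧ star G n a = B) ∨
    (∃ Q : Finset V, IsIsolatedClique G n Q ∧ a ∈ Q ∧ star G n a = Q) ∨ star G n a = ∅ := by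
  by_cases h1 : ∃ P : Finset V, G.IsNClique (n + 1) P ∧ a ∈ P
  · obtain ⟨P, hP, ha⟩ := h1
    exact Or.inl ⟨P, hP, ha, hG.star_eq_of_isNClique_succ hn hP ha⟩
  push Not at h1
  by_cases h2 : ∃ B : Finset V, IsKernel G n B ∧ G.IsClique (insert a (B : Set V))
  · obtain ⟨B, hB, ha⟩ := h2
    exact Or.inr (Or.inl ⟨B, hB, ha, h1, hG.star_eq_of_isKernel hn hB ha h1⟩)
  by_cases h3 : ∃ Q : Finset V, IsIsolatedClique G n Q ∧ a ∈ Q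
  · obtain ⟨Q, hQ, ha⟩ := h3
    exact Or.inr (Or.inr (Or.inl ⟨Q, hQ, ha, hQ.star_eq hn ha⟩))
  · refine Or.inr (Or.inr (Or.inr (Set.eq_empty_iff_forall_notMem.2 ?_)))
    rintro b ⟨B, hB, hclq, -⟩
    rcases isSpecial_iff.1 hB with hB | hB
    · exact h3 ⟨B, hB, hB.mem_of_isClique_insert hn hclq⟩
    · exact h2 ⟨B, hB, hclq⟩

lemma encard_insert_star_le (hn : 3 ≤ n) (a : V) :
    (insert a (star G n a)).encard ≤ (n : ℕ∞) + 1 := by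
  rcases hG.star_cases hn a with ⟨P, hP, ha, h⟩ | ⟨B, hB, -, -, h⟩ | ⟨Q, hQ, ha, h⟩ | h
  · rw [h, Set.insert_eq_of_mem (by exact ha), Set.encard_coe_eq_coe_finsetCard, hP.card_eq]
    simp
  · rw [h]
    refine (Set.encard_insert_le _ _).trans ?_
    rw [Set.encard_coe_eq_coe_finsetCard]
    have := hB.2.1
    have : (B.card : ℕ∞) ≤ n := by exact_mod_cast (by omega : B.card ≤ n)
    gcongr
  · rw [h, Set.insert_eq_of_mem (by exact ha), Set.encard_coe_eq_coe_finsetCard, hQ.1.card_eq]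
    exact le_self_add
  · rw [h]
    simp

lemma finite_star (hn : 3 ≤ n) (a : V) : (star G n a).Finite := by
  rcases hG.star_cases hn a with ⟨P, -, -, h⟩ | ⟨B, -, -, -, h⟩ | ⟨Q, -, -, h⟩ | h <;> rw [h]
  exacts [P.finite_toSet, B.finite_toSet, Q.finite_toSet, Set.finite_empty]

/-- In the kernel case, an `(n + 1)`-clique through `c` would absorb the `n`-clique containing `a`
and `B`, so `c` too falls under `star_eq_of_isKernel`. -/
lemma star_subset_of_mem {a c : V} (hn : 3 ≤ n) (hc : c ∈ star G n a) :
    star G n c ⊆ star G n a := by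
  rcases hG.star_cases hn a with ⟨P, hP, -, h⟩ | ⟨B, hB, hclq, hno, h⟩ | ⟨Q, hQ, -, h⟩ | h <;>
    rw [h] at hc ⊢
  · rw [hG.star_eq_of_isNClique_succ hn hP hc]
  · obtain ⟨Q, hQ, haQ, hBQ⟩ := hB.exists_isNClique hclq
    rw [hG.star_eq_of_isKernel hn hB (by rw [Set.insert_eq_of_mem hc]; exact hB.1)]
    exact fun P hP hcP => hno P hP (hG.subset_of_isNClique_succ hn hP hQ.1
      (by rw [hQ.card_eq]; exact hn) hcP (hBQ hc) haQ)
  · rw [hQ.star_eq hn hc]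
  · exact absurd hc (Set.notMem_empty c)

/-- An isolated clique would be `v*`, so another `n`-clique meets `Q`, and their intersection is a
kernel. -/
lemma exists_isKernel_of_not_subset_star {Q : Finset V} {v : V} (hn : 3 ≤ n)
    (hQ : G.IsNClique n Q) (hv : v ∈ Q) (hsub : ¬ (Q : Set V) ⊆ star G n v) :
    ∃ B ⊆ Q, IsKernel G n B ∧ (B : Set V) ⊆ star G n v := by
  classical
  by_cases hiso : IsIsolatedClique G n Q
  · exact absurd (hiso.star_eq hn hv).ge hsub
  · have : ∃ R : Finset V, G.IsNClique n R ∧ ∃ x ∈ R, x ∈ Q ∧ R ≠ Q := by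
      by_contra! hcon
      exact hiso ⟨hQ, fun R hR x hx hxQ => hcon R hR x hx hxQ⟩
    obtain ⟨R, hR, x, hxR, hxQ, hne⟩ := this
    have hker := hG.isKernel_inter hQ hR hne hxQ hxR
    refine ⟨Q ∩ R, Finset.inter_subset_left, hker, fun b hb =>
      ⟨Q ∩ R, isSpecial_iff.2 (Or.inr hker), hQ.1.subset ?_, hb⟩⟩
    exact Set.insert_subset hv (by simp)

/-- The triangle must meet both `B ∪ {p}` and `B ∪ {q}` again, so `y` and `z` are `p` and `q`; being
adjacent, they complete `B` to an `(n + 1)`-clique, which is `v*`. -/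
lemma mem_star_of_triangle {B : Finset V} {v y z : V} (hn : 3 ≤ n) (hB : IsKernel G n B)
    (hv : v ∈ B) (hvy : G.Adj v y) (hvz : G.Adj v z) (hyz : G.Adj y z) (hy : y ∉ B) (hz : z ∉ B) :
    y ∈ star G n v ∧ z ∈ star G n v := by
  classical
  obtain ⟨hcl, hc, p, q, hpq, hp, hq⟩ := id hB
  have key : ∀ x, (∀ v ∈ B, G.Adj x v) → y = x ∨ z = x := by
    intro x hx
    have hQ := isNClique_insert_of_forall_adj hcl hc hx
    rcases hG _ hQ.1 hQ.2 v (Finset.mem_insert_of_mem hv) y z hvy hvz hyz with h | h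
    · exact Or.inl ((Finset.mem_insert.1 h).resolve_right hy)
    · exact Or.inr ((Finset.mem_insert.1 h).resolve_right hz)
  have hyz' : (∀ v ∈ B, G.Adj y v) ∧ (∀ v ∈ B, G.Adj z v) := by
    rcases key p hp with rfl | rfl <;> rcases key q hq with rfl | rfl
    exacts [absurd rfl hpq, ⟨hp, hq⟩, ⟨hq, hp⟩, absurd rfl hpq]
  have hP := hB.isNClique_succ hyz'.1 hyz'.2 hyz
  rw [hG.star_eq_of_isNClique_succ hn hP (by simp [hv])]
  simp

end CliqueTriangleFree

end Clusters

/-! ### Free amalgamation over closed sets. -/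

section Amalgam

/-- A set of pairs that is an isomorphism between induced subgraphs of `G₁` and `G₂`. -/
structure IsPartialIso {V₁ V₂ : Type*} (G₁ : SimpleGraph V₁) (G₂ : SimpleGraph V₂)
    (p : Set (V₁ × V₂)) : Prop where
  eq_iff : ∀ x ∈ p, ∀ y ∈ p, (x.1 = y.1 ↔ x.2 = y.2)
  adj_iff : ∀ x ∈ p, ∀ y ∈ p, (G₁.Adj x.1 y.1 ↔ G₂.Adj x.2 y.2)

/-- `H` is the union of copies of `G₁` and `G₂` identified along `p`, without further edges. -/
structure IsFreeAmalgam {V₁ V₂ W : Type*} {G₁ : SimpleGraph V₁} {G₂ : SimpleGraph V₂}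
    {H : SimpleGraph W} (e₁ : G₁ ↪g H) (e₂ : G₂ ↪g H) (p : Set (V₁ × V₂)) : Prop where
  eq_iff : ∀ x y, e₁ x = e₂ y ↔ (x, y) ∈ p
  adj : ∀ a b, H.Adj a b → (a ∈ Set.range e₁ ∧ b ∈ Set.range e₁) ∨
    (a ∈ Set.range e₂ ∧ b ∈ Set.range e₂)
  mem : ∀ a, a ∈ Set.range e₁ ∨ a ∈ Set.range e₂

lemma IsFreeAmalgam.countable {V₁ V₂ W : Type*} {G₁ : SimpleGraph V₁} {G₂ : SimpleGraph V₂}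
    {H : SimpleGraph W} {e₁ : G₁ ↪g H} {e₂ : G₂ ↪g H} {p : Set (V₁ × V₂)}
    (h : IsFreeAmalgam e₁ e₂ p) [Countable V₁] [Countable V₂] : Countable W := by
  rw [← Set.countable_univ_iff]
  exact ((Set.countable_range e₁).union (Set.countable_range e₂)).mono fun a _ => h.mem a

lemma IsFreeAmalgam.symm {V₁ V₂ W : Type*} {G₁ : SimpleGraph V₁} {G₂ : SimpleGraph V₂}
    {H : SimpleGraph W} {e₁ : G₁ ↪g H} {e₂ : G₂ ↪g H} {p : Set (V₁ × V₂)}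
    (h : IsFreeAmalgam e₁ e₂ p) : IsFreeAmalgam e₂ e₁ (Prod.swap ⁻¹' p) :=
  ⟨fun x y => eq_comm.trans (h.eq_iff y x), fun a b hab => (h.adj a b hab).symm,
    fun a => (h.mem a).symm⟩

lemma IsPartialIso.exists_isFreeAmalgam {V₁ V₂ : Type u} {G₁ : SimpleGraph V₁}
    {G₂ : SimpleGraph V₂} {p : Set (V₁ × V₂)} (hp : IsPartialIso G₁ G₂ p) :
    ∃ (W : Type u) (H : SimpleGraph W) (e₁ : G₁ ↪g H) (e₂ : G₂ ↪g H), IsFreeAmalgam e₁ e₂ p := by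
  classical
  let W := V₁ ⊕ {w : V₂ // w ∉ Prod.snd '' p}
  let f₁ : V₁ ↪ W := ⟨Sum.inl, Sum.inl_injective⟩
  let g : V₂ → W := fun w => if h : ∃ a, (a, w) ∈ p then Sum.inl h.choose else
    Sum.inr ⟨w, by rintro ⟨⟨a, w'⟩, hm, rfl⟩; exact h ⟨a, hm⟩⟩
  have g_pos : ∀ a w, (a, w) ∈ p → g w = Sum.inl a := by
    intro a w h
    have h' : ∃ a, (a, w) ∈ p := ⟨a, h⟩
    simp only [g, dif_pos h']
    exact congrArg _ ((hp.eq_iff _ h'.choose_spec _ h).2 rfl)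
  have g_neg : ∀ w (h : ¬ ∃ a, (a, w) ∈ p), ∃ h', g w = Sum.inr ⟨w, h'⟩ := by
    intro w h
    exact ⟨_, dif_neg h⟩
  have g_inj : Function.Injective g := by
    intro w w' hww
    by_cases h : ∃ a, (a, w) ∈ p <;> by_cases h' : ∃ a, (a, w') ∈ p
    · obtain ⟨a, ha⟩ := h
      obtain ⟨a', ha'⟩ := h'
      rw [g_pos a w ha, g_pos a' w' ha', Sum.inl.injEq] at hww
      exact (hp.eq_iff _ ha _ ha').1 hww
    · obtain ⟨a, ha⟩ := h
      obtain ⟨_, h'⟩ := g_neg w' h'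
      rw [g_pos a w ha, h'] at hww
      cases hww
    · obtain ⟨a, ha⟩ := h'
      obtain ⟨_, h'⟩ := g_neg w h
      rw [g_pos a w' ha, h'] at hww
      cases hww
    · obtain ⟨_, h1⟩ := g_neg w h
      obtain ⟨_, h2⟩ := g_neg w' h'
      rw [h1, h2, Sum.inr.injEq] at hww
      exact congrArg Subtype.val hww
  have eq_iff : ∀ x y, f₁ x = g y ↔ (x, y) ∈ p := by
    intro x y
    constructor
    · intro h
      by_cases hy : ∃ a, (a, y) ∈ p
      · obtain ⟨a, ha⟩ := hy
        rw [g_pos a y ha] at h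
        rwa [show x = a from Sum.inl_injective h]
      · obtain ⟨_, h1⟩ := g_neg y hy
        rw [h1] at h
        cases h
    · exact fun h => (g_pos x y h).symm
  let f₂ : V₂ ↪ W := ⟨g, g_inj⟩
  have eq_iff' : ∀ x y, f₁ x = f₂ y ↔ (x, y) ∈ p := eq_iff
  refine ⟨W, G₁.map f₁ ⊔ G₂.map f₂, ⟨f₁, ?_⟩, ⟨f₂, ?_⟩, ⟨eq_iff', ?_, ?_⟩⟩
  · intro a b
    rw [SimpleGraph.sup_adj, SimpleGraph.map_adj_apply]
    refine ⟨?_, Or.inl⟩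
    rintro (h | h)
    · exact h
    · rw [SimpleGraph.map_adj] at h
      obtain ⟨c, d, hcd, hc, hd⟩ := h
      exact (hp.adj_iff _ ((eq_iff' a c).1 hc.symm) _ ((eq_iff' b d).1 hd.symm)).2 hcd
  · intro a b
    rw [SimpleGraph.sup_adj, SimpleGraph.map_adj_apply]
    refine ⟨?_, Or.inr⟩
    rintro (h | h)
    · rw [SimpleGraph.map_adj] at h
      obtain ⟨c, d, hcd, hc, hd⟩ := h
      exact (hp.adj_iff _ ((eq_iff' c a).1 hc) _ ((eq_iff' d b).1 hd)).1 hcd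
    · exact h
  · intro a b hab
    rw [SimpleGraph.sup_adj, SimpleGraph.map_adj, SimpleGraph.map_adj] at hab
    rcases hab with ⟨c, d, -, rfl, rfl⟩ | ⟨c, d, -, rfl, rfl⟩
    · exact Or.inl ⟨⟨c, rfl⟩, ⟨d, rfl⟩⟩
    · exact Or.inr ⟨⟨c, rfl⟩, ⟨d, rfl⟩⟩
  · rintro (a | ⟨w, hw⟩)
    · exact Or.inl ⟨a, rfl⟩
    · refine Or.inr ⟨w, ?_⟩
      have : ¬ ∃ a, (a, w) ∈ p := fun ⟨a, ha⟩ => hw ⟨(a, w), ha, rfl⟩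
      obtain ⟨_, h⟩ := g_neg w this
      exact h

/-- A partial isomorphism with closed domain and range that respects kernels. -/
structure IsClosedPartialIso (n : ℕ) {V₁ V₂ : Type*} (G₁ : SimpleGraph V₁) (G₂ : SimpleGraph V₂)
    (p : Set (V₁ × V₂)) : Prop extends IsPartialIso G₁ G₂ p where
  left : ∀ x ∈ p, ∀ a ∈ star G₁ n x.1, ∃ b, (a, b) ∈ p
  right : ∀ x ∈ p, ∀ b ∈ star G₂ n x.2, ∃ a, (a, b) ∈ p
  isKernel_iff : ∀ (B : Finset V₁) (D : Finset V₂), (∀ b ∈ B, ∃ d ∈ D, (b, d) ∈ p) →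
    (∀ d ∈ D, ∃ b ∈ B, (b, d) ∈ p) → (IsKernel G₁ n B ↔ IsKernel G₂ n D)

lemma IsClosedPartialIso.symm {n : ℕ} {V₁ V₂ : Type*} {G₁ : SimpleGraph V₁} {G₂ : SimpleGraph V₂}
    {p : Set (V₁ × V₂)} (hp : IsClosedPartialIso n G₁ G₂ p) :
    IsClosedPartialIso n G₂ G₁ (Prod.swap ⁻¹' p) where
  eq_iff _ hx _ hy := (hp.eq_iff _ hx _ hy).symm
  adj_iff _ hx _ hy := (hp.adj_iff _ hx _ hy).symm
  left _ hx := hp.right _ hx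
  right _ hx := hp.left _ hx
  isKernel_iff B D hB hD := (hp.isKernel_iff D B hD hB).symm

variable {n : ℕ} {V₁ V₂ W : Type*} {G₁ : SimpleGraph V₁} {G₂ : SimpleGraph V₂} {H : SimpleGraph W}

lemma isClique_preimage (e : G₁ ↪g H) {Q : Finset W} (hQ : H.IsClique (Q : Set W)) :
    G₁.IsClique (Q.preimage e e.injective.injOn : Set V₁) := by
  intro a ha b hb hab
  rw [Finset.coe_preimage] at ha hb
  exact e.map_adj_iff.1 (hQ ha hb (e.injective.ne hab))

lemma card_preimage_of_subset_range (e : G₁ ↪g H) {Q : Finset W}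
    (hQ : ∀ a ∈ Q, a ∈ Set.range e) : (Q.preimage e e.injective.injOn).card = Q.card := by
  classical
  rw [← Finset.card_image_of_injective _ e.injective, Finset.image_preimage,
    Finset.filter_true_of_mem hQ]

lemma CliqueTriangleFree.mem_or_mem_of_subset_range (hG : CliqueTriangleFree n G₁) (e : G₁ ↪g H)
    {Q : Finset W} (hQ : H.IsClique (Q : Set W)) (hc : Q.card = n)
    (hr : ∀ a ∈ Q, a ∈ Set.range e) {v x y : W} (hv : v ∈ Q) (hx : x ∈ Set.range e)
    (hy : y ∈ Set.range e) (hvx : H.Adj v x) (hvy : H.Adj v y) (hxy : H.Adj x y) :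
    x ∈ Q ∨ y ∈ Q := by
  obtain ⟨v, rfl⟩ := hr v hv
  obtain ⟨x, rfl⟩ := hx
  obtain ⟨y, rfl⟩ := hy
  have := hG _ (isClique_preimage e hQ) (by rw [card_preimage_of_subset_range e hr, hc]) v
    (Finset.mem_preimage.2 hv) x y (e.map_adj_iff.1 hvx) (e.map_adj_iff.1 hvy)
    (e.map_adj_iff.1 hxy)
  simpa only [Finset.mem_preimage] using this

/-- The mixed case: clique on the first side, triangle on the second. If `Q` leaves the common part,
then `Q` is a shared kernel `B` plus one private vertex, and `v` is in `B`. A triangle at `v`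
avoiding the rest of `Q` would lie in `v*` as computed on the second side, hence in the common part,
contradicting freeness of the first side. -/
lemma IsFreeAmalgam.mem_or_mem (hn : 3 ≤ n) {e₁ : G₁ ↪g H} {e₂ : G₂ ↪g H} {p : Set (V₁ × V₂)}
    (h : IsFreeAmalgam e₁ e₂ p) (h₁ : CliqueTriangleFree n G₁) (h₂ : CliqueTriangleFree n G₂)
    (hp : IsClosedPartialIso n G₁ G₂ p) {Q : Finset W} (hQ : H.IsClique (Q : Set W))
    (hc : Q.card = n) (hr : ∀ a ∈ Q, a ∈ Set.range e₁) {v x y : W} (hv : v ∈ Q)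
    (hv₂ : v ∈ Set.range e₂) (hx : x ∈ Set.range e₂) (hy : y ∈ Set.range e₂) (hvx : H.Adj v x)
    (hvy : H.Adj v y) (hxy : H.Adj x y) : x ∈ Q ∨ y ∈ Q := by
  classical
  by_cases hr₂ : ∀ a ∈ Q, a ∈ Set.range e₂
  · exact h₂.mem_or_mem_of_subset_range e₂ hQ hc hr₂ hv hx hy hvx hvy hxy
  push Not at hr₂
  obtain ⟨w, hwQ, hw⟩ := hr₂
  obtain ⟨w, rfl⟩ := hr w hwQ
  obtain ⟨v₁, rfl⟩ := hr v hv
  obtain ⟨v₂, hv₁₂⟩ := hv₂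
  obtain ⟨x, rfl⟩ := hx
  obtain ⟨y, rfl⟩ := hy
  have hvp : (v₁, v₂) ∈ p := (h.eq_iff _ _).1 hv₁₂.symm
  have hdom : ∀ a ∈ star G₁ n v₁, e₁ a ∈ Set.range e₂ := by
    intro a ha
    obtain ⟨b, hb⟩ := hp.left _ hvp a ha
    exact ⟨b, ((h.eq_iff _ _).2 hb).symm⟩
  set Q₁ := Q.preimage e₁ e₁.injective.injOn with hQ₁
  have hQ₁c : G₁.IsNClique n Q₁ :=
    ⟨isClique_preimage e₁ hQ, by rw [card_preimage_of_subset_range e₁ hr, hc]⟩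
  have hwQ₁ : w ∈ Q₁ := Finset.mem_preimage.2 hwQ
  have hvQ₁ : v₁ ∈ Q₁ := Finset.mem_preimage.2 hv
  obtain ⟨B, hBQ, hB, hBs⟩ := h₁.exists_isKernel_of_not_subset_star hn hQ₁c hvQ₁
    fun hs => hw (hdom w (hs hwQ₁))
  have hwB : w ∉ B := fun hwB => hw (hdom w (hBs hwB))
  have hQB : insert w B = Q₁ := by
    refine Finset.eq_of_subset_of_card_le (Finset.insert_subset hwQ₁ hBQ) ?_
    rw [Finset.card_insert_of_notMem hwB, hB.2.1, hQ₁c.card_eq]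
  have hvB : v₁ ∈ B := by
    rw [← hQB] at hvQ₁
    refine (Finset.mem_insert.1 hvQ₁).resolve_left ?_
    rintro rfl
    exact hw ⟨v₂, hv₁₂⟩
  set D := (B.image e₁).preimage e₂ e₂.injective.injOn with hD
  have hDmem : ∀ d, d ∈ D ↔ ∃ b ∈ B, (b, d) ∈ p := by
    intro d
    simp only [hD, Finset.mem_preimage, Finset.mem_image, h.eq_iff]
  have hDk : IsKernel G₂ n D := by
    refine (hp.isKernel_iff B D (fun b hb => ?_) fun d hd => (hDmem d).1 hd).1 hB
    obtain ⟨d, hd⟩ := hp.left _ hvp b (hBs hb)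
    exact ⟨d, (hDmem d).2 ⟨b, hb, hd⟩, hd⟩
  have hDQ : ∀ d ∈ D, e₂ d ∈ Q := by
    intro d hd
    obtain ⟨b, hb, hbd⟩ := (hDmem d).1 hd
    rw [← (h.eq_iff _ _).2 hbd]
    exact Finset.mem_preimage.1 (hBQ hb)
  by_contra! hcon
  rw [← hv₁₂] at hvx hvy
  obtain ⟨hx', hy'⟩ := h₂.mem_star_of_triangle hn hDk ((hDmem v₂).2 ⟨v₁, hvB, hvp⟩)
    (e₂.map_adj_iff.1 hvx) (e₂.map_adj_iff.1 hvy) (e₂.map_adj_iff.1 hxy)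
    (fun hd => hcon.1 (hDQ _ hd)) (fun hd => hcon.2 (hDQ _ hd))
  obtain ⟨x₁, hx₁⟩ := hp.right _ hvp _ hx'
  obtain ⟨y₁, hy₁⟩ := hp.right _ hvp _ hy'
  rw [hv₁₂] at hvx hvy
  rcases h₁.mem_or_mem_of_subset_range e₁ hQ hc hr hv ⟨x₁, (h.eq_iff _ _).2 hx₁⟩
    ⟨y₁, (h.eq_iff _ _).2 hy₁⟩ hvx hvy hxy with h' | h'
  exacts [hcon.1 h', hcon.2 h']

/-- No edge joins vertices private to different sides. -/
lemma IsFreeAmalgam.clique_subset_range {e₁ : G₁ ↪g H} {e₂ : G₂ ↪g H} {p : Set (V₁ × V₂)}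
    (h : IsFreeAmalgam e₁ e₂ p) {S : Set W} (hS : H.IsClique S) :
    S ⊆ Set.range e₁ ∨ S ⊆ Set.range e₂ := by
  by_contra! hcon
  obtain ⟨h1, h2⟩ := hcon
  obtain ⟨a, haS, ha⟩ := Set.not_subset.1 h1
  obtain ⟨b, hbS, hb⟩ := Set.not_subset.1 h2
  have hab : a ≠ b := by
    rintro rfl
    exact (h.mem a).elim ha hb
  rcases h.adj a b (hS haS hbS hab) with h' | h'
  exacts [ha h'.1, hb h'.2]

theorem IsFreeAmalgam.cliqueTriangleFree (hn : 3 ≤ n) {e₁ : G₁ ↪g H} {e₂ : G₂ ↪g H}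
    {p : Set (V₁ × V₂)} (h : IsFreeAmalgam e₁ e₂ p) (h₁ : CliqueTriangleFree n G₁)
    (h₂ : CliqueTriangleFree n G₂) (hp : IsClosedPartialIso n G₁ G₂ p) :
    CliqueTriangleFree n H := by
  intro Q hQ hc v hv x y hvx hvy hxy
  have hT : H.IsClique ({v, x, y} : Set W) := by
    simp [SimpleGraph.isClique_insert, hvx, hvy, hxy]
  rcases h.clique_subset_range hQ with hr | hr <;> rcases h.clique_subset_range hT with hr' | hr'
  · exact h₁.mem_or_mem_of_subset_range e₁ hQ hc hr hv (hr' (by simp)) (hr' (by simp)) hvx hvy hxy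
  · exact h.mem_or_mem hn h₁ h₂ hp hQ hc hr hv (hr' (by simp)) (hr' (by simp)) (hr' (by simp))
      hvx hvy hxy
  · exact h.symm.mem_or_mem hn h₂ h₁ hp.symm hQ hc hr hv (hr' (by simp)) (hr' (by simp))
      (hr' (by simp)) hvx hvy hxy
  · exact h₂.mem_or_mem_of_subset_range e₂ hQ hc hr hv (hr' (by simp)) (hr' (by simp)) hvx hvy hxy

end Amalgam

/-! ### Algebraic closure is closure under `*`. -/

section AlgebraicClosure

lemma IsEmbeddingOn.isClique_image {V' V : Type*} {H : SimpleGraph V'} {G : SimpleGraph V}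
    {S T : Set V'} {h : V' → V} (hh : IsEmbeddingOn H G S h) (hT : H.IsClique T) (hTS : T ⊆ S) :
    G.IsClique (h '' T) := by
  rintro _ ⟨x, hx, rfl⟩ _ ⟨y, hy, rfl⟩ hne
  exact (hh.2 x (hTS hx) y (hTS hy)).2 (hT hx hy (by rintro rfl; exact hne rfl))

lemma IsEmbeddingOn.isNClique_image {V' V : Type*} [DecidableEq V]
    {H : SimpleGraph V'} {G : SimpleGraph V} {n : ℕ} {S : Set V'} {h : V' → V}
    (hh : IsEmbeddingOn H G S h) {Q : Finset V'} (hQ : H.IsNClique n Q) (hQS : ↑Q ⊆ S) :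
    G.IsNClique n (Q.image h) := by
  refine ⟨?_, ?_⟩
  · rw [Finset.coe_image]
    exact hh.isClique_image hQ.1 hQS
  · rw [Finset.card_image_of_injOn (hh.1.mono hQS), hQ.card_eq]

lemma IsEmbeddingOn.isKernel_image {V' V : Type*} [DecidableEq V] {H : SimpleGraph V'}
    {G : SimpleGraph V} {n : ℕ} {S : Set V'} {h : V' → V} (hh : IsEmbeddingOn H G S h)
    {B : Finset V'} (hB : H.IsClique (B : Set V')) (hc : B.card + 1 = n) (hBS : ↑B ⊆ S) {x y : V'}
    (hxy : x ≠ y) (hxS : x ∈ S) (hyS : y ∈ S) (hx : ∀ v ∈ B, H.Adj x v) (hy : ∀ v ∈ B, H.Adj y v) :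
    IsKernel G n (B.image h) := by
  refine ⟨?_, ?_, h x, h y, fun e => hxy (hh.1 hxS hyS e), ?_, ?_⟩
  · rw [Finset.coe_image]
    exact hh.isClique_image hB hBS
  · rw [Finset.card_image_of_injOn (hh.1.mono hBS), hc]
  · intro v hv
    obtain ⟨b, hb, rfl⟩ := Finset.mem_image.1 hv
    exact (hh.2 _ hxS _ (hBS hb)).2 (hx b hb)
  · intro v hv
    obtain ⟨b, hb, rfl⟩ := Finset.mem_image.1 hv
    exact (hh.2 _ hyS _ (hBS hb)).2 (hy b hb)

variable {V : Type u} {G : SimpleGraph V} {n : ℕ}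

/-- Embeddings fixing `a` carry an isolated clique through `a` onto itself, and a kernel forming a
clique with `a`, if its two witnesses are carried along, to another such kernel, hence into the
finite set `a*`. -/
lemma CliqueTriangleFree.star_subset_acl (hG : CliqueTriangleFree n G) (hn : 3 ≤ n) {A : Set V}
    {a : V} (ha : a ∈ A) : star G n a ⊆ acl G A := by
  classical
  rintro b ⟨B, hB, hclq, hb⟩
  rcases isSpecial_iff.1 hB with hB | ⟨hcl, hc, x, y, hxy, hx, hy⟩
  · have haB := hB.mem_of_isClique_insert hn hclq
    refine mem_acl_of_finite B.finite_toSet (B.finite_toSet.subset ?_)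
    rintro _ ⟨h, hh, hfix, rfl⟩
    have := hB.2 _ (hh.isNClique_image hB.1 subset_rfl) a
      (Finset.mem_image.2 ⟨a, haB, hfix a haB ha⟩) haB
    rw [← this]
    exact Finset.mem_coe.2 (Finset.mem_image_of_mem h hb)
  · refine mem_acl_of_finite (S := ↑(insert a (insert x (insert y B)))) (Finset.finite_toSet _)
      ((hG.finite_star hn a).subset ?_)
    rintro _ ⟨h, hh, hfix, rfl⟩
    have hsub : (B : Set V) ⊆ ↑(insert a (insert x (insert y B))) := by
      intro z hz
      simp [Finset.mem_coe.1 hz]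
    refine ⟨B.image h, isSpecial_iff.2 (Or.inr (hh.isKernel_image hcl hc hsub hxy (by simp)
      (by simp) hx hy)), ?_, Finset.mem_image_of_mem h hb⟩
    have h1 := hh.isClique_image hclq (Set.insert_subset (by simp) hsub)
    rw [Set.image_insert_eq, hfix a (by simp) ha] at h1
    rwa [Finset.coe_image]

lemma isCountableFree_iff (hn : 3 ≤ n) : IsCountableFree (cliqueWithTriangle n) G ↔
    Countable V ∧ CliqueTriangleFree n G := by
  rw [IsCountableFree, free_cliqueWithTriangle_iff (by omega)]

lemma isClosedPartialIso_diagonal {A : Set V} (hA : ∀ a ∈ A, star G n a ⊆ A) :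
    IsClosedPartialIso n G G ((fun a => (a, a)) '' A) where
  eq_iff := by
    rintro _ ⟨x, -, rfl⟩ _ ⟨y, -, rfl⟩
    rfl
  adj_iff := by
    rintro _ ⟨x, -, rfl⟩ _ ⟨y, -, rfl⟩
    rfl
  left := by
    rintro _ ⟨x, hx, rfl⟩ a ha
    exact ⟨a, a, hA x hx ha, rfl⟩
  right := by
    rintro _ ⟨x, hx, rfl⟩ a ha
    exact ⟨a, a, hA x hx ha, rfl⟩
  isKernel_iff B D hB hD := by
    have : B = D := by
      ext b
      constructor
      · intro hb
        obtain ⟨d, hd, c, -, ⟨⟩⟩ := hB b hb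
        exact hd
      · intro hd
        obtain ⟨d, hd, c, -, ⟨⟩⟩ := hD b hd
        exact hd
    rw [this]

/-- Glue `G` to itself over `A` and retract the second copy into `G`, fixing all of the finitely
many candidate images of `b`. The image of the second copy of `b` is a candidate, so by injectivity
the two copies meet there, which happens only over `A`. -/
lemma IsExistentiallyComplete.acl_subset (hn : 3 ≤ n)
    (hG : IsExistentiallyComplete (cliqueWithTriangle n) G) {A : Set V}
    (hA : ∀ a ∈ A, star G n a ⊆ A) : acl G A ⊆ A := by
  intro b hb
  obtain ⟨S, hS, hbS, hX⟩ := exists_finite_of_mem_acl hb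
  obtain ⟨hcount, hfree⟩ := (isCountableFree_iff hn).1 hG.1
  have hp := isClosedPartialIso_diagonal hA
  obtain ⟨W, H, e₁, e₂, hH⟩ := hp.exists_isFreeAmalgam
  obtain ⟨h, hh, hfix⟩ := hG.hasFiniteRetractions W H e₁
    ((isCountableFree_iff hn).2 ⟨hH.countable, hH.cliqueTriangleFree hn hfree hfree hp⟩)
    -- The underscore is the finite set of candidate images of `b`.
    (e₂ '' S ∪ e₁ '' (_ ∪ S ∩ A)) ((hS.image _).union ((hX.union (hS.inter_of_left A)).image _))
  have hx : h (e₂ b) ∈ {x | ∃ h : V → V, IsEmbeddingOn G G S h ∧ (∀ a ∈ S, a ∈ A → h a = a) ∧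
      h b = x} := by
    refine ⟨h ∘ e₂, ⟨?_, ?_⟩, ?_, rfl⟩
    · intro x hx y hy e
      exact e₂.injective (hh.1 (Or.inl ⟨x, hx, rfl⟩) (Or.inl ⟨y, hy, rfl⟩) e)
    · intro x hx y hy
      rw [← e₂.map_adj_iff (v := x)]
      exact hh.2 _ (Or.inl ⟨x, hx, rfl⟩) _ (Or.inl ⟨y, hy, rfl⟩)
    · intro a haS haA
      have : e₁ a = e₂ a := (hH.eq_iff a a).2 ⟨a, haA, rfl⟩
      rw [Function.comp_apply, ← this]
      exact hfix a (Or.inr ⟨a, Or.inr ⟨haS, haA⟩, rfl⟩)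
  have h1 : e₁ (h (e₂ b)) ∈ e₂ '' S ∪ e₁ '' (_ ∪ S ∩ A) := Or.inr ⟨_, Or.inl hx, rfl⟩
  have h2 := hh.1 h1 (Or.inl ⟨b, hbS, rfl⟩) (hfix _ h1)
  obtain ⟨c, hc, e⟩ := (hH.eq_iff _ _).1 h2
  rwa [show c = b from (Prod.ext_iff.1 e).2] at hc

theorem IsExistentiallyComplete.eq_acl_iff (hn : 3 ≤ n)
    (hG : IsExistentiallyComplete (cliqueWithTriangle n) G) (A : Set V) :
    A = acl G A ↔ ∀ a ∈ A, star G n a ⊆ A := by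
  constructor
  · intro h a ha
    rw [h]
    exact ((isCountableFree_iff hn).1 hG.1).2.star_subset_acl hn ha
  · exact fun h => subset_acl.antisymm (hG.acl_subset hn h)

lemma CliqueTriangleFree.star_subset_biUnion (hG : CliqueTriangleFree n G) (hn : 3 ≤ n)
    (A : Set V) : ∀ a ∈ ⋃ a ∈ A, insert a (star G n a),
      star G n a ⊆ ⋃ a ∈ A, insert a (star G n a) := by
  intro c hc
  rw [Set.mem_iUnion₂] at hc
  obtain ⟨a, ha, hca⟩ := hc
  refine subset_trans ?_ (Set.subset_biUnion_of_mem (u := fun a => insert a (star G n a)) ha)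
  rcases hca with rfl | hca
  · exact Set.subset_insert _ _
  · exact (hG.star_subset_of_mem hn hca).trans (Set.subset_insert _ _)

lemma _root_.Set.encard_biUnion_le_mul {ι α : Type*} (A : Set ι) (f : ι → Set α) (k : ℕ∞)
    (hk : k ≠ 0) (hf : ∀ i, (f i).encard ≤ k) : (⋃ i ∈ A, f i).encard ≤ k * A.encard := by
  rcases A.finite_or_infinite with hA | hA
  · induction A, hA using Set.Finite.induction_on with
    | empty => simp
    | @insert a s has hs ih =>
      rw [Set.biUnion_insert, Set.encard_insert_of_notMem has, mul_add, mul_one, add_comm]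
      exact (Set.encard_union_le _ _).trans (add_le_add (hf a) ih)
  · rw [hA.encard_eq, ENat.mul_top hk]
    exact le_top

theorem IsExistentiallyComplete.encard_acl_le (hn : 3 ≤ n)
    (hG : IsExistentiallyComplete (cliqueWithTriangle n) G) (A : Set V) :
    (acl G A).encard ≤ ((n : ℕ∞) + 1) * A.encard := by
  have hfree := ((isCountableFree_iff hn).1 hG.1).2
  have hsub : A ⊆ ⋃ a ∈ A, insert a (star G n a) :=
    fun a ha => Set.mem_biUnion ha (Set.mem_insert _ _)
  refine le_trans (Set.encard_le_encard ((acl_mono hsub).trans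
    (hG.acl_subset hn (hfree.star_subset_biUnion hn A)))) ?_
  exact Set.encard_biUnion_le_mul A _ _ (by simp) (hfree.encard_insert_star_le hn)

end AlgebraicClosure

/-! ### Generic construction of existentially complete graphs. -/

section Extension

lemma free_induce_image {W V' V : Type*} {C : SimpleGraph W} {H : SimpleGraph V'}
    {G : SimpleGraph V} {T : Set V'} {g : V' → V} (hH : C.Free H) (hg : IsEmbeddingOn H G T g) :
    C.Free (G.induce (g '' T)) := by
  rintro ⟨c⟩
  have : ∀ w, ∃ z ∈ T, g z = c w := fun w => (c w).2
  choose z hzT hz using this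
  refine hH ⟨⟨⟨z, fun {a b} hab => ?_⟩, fun a b hab => ?_⟩⟩
  · have h1 : G.Adj (c a) (c b) := c.toHom.map_adj hab
    rw [← hz, ← hz] at h1
    exact (hg.2 _ (hzT a) _ (hzT b)).1 h1
  · refine c.injective (Subtype.ext ?_)
    change (c a : V) = c b
    rw [← hz, ← hz]
    exact congrArg g hab

/-- The graph on `V` whose edges are the images under `g` of the edges of `H` within `T`. -/
def imageOn {V' V : Type*} (H : SimpleGraph V') (T : Set V') (g : V' → V) (hg : Set.InjOn g T) :
    SimpleGraph V where
  Adj x y := ∃ z ∈ T, ∃ w ∈ T, g z = x ∧ g w = y ∧ H.Adj z w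
  symm := ⟨by
    rintro x y ⟨z, hz, w, hw, h1, h2, h3⟩
    exact ⟨w, hw, z, hz, h2, h1, h3.symm⟩⟩
  loopless := ⟨by
    rintro x ⟨z, hz, w, hw, h1, h2, h3⟩
    exact h3.ne (hg hz hw (h1.trans h2.symm))⟩

lemma isEmbeddingOn_imageOn {V' V : Type*} (H : SimpleGraph V') (T : Set V') (g : V' → V)
    (hg : Set.InjOn g T) : IsEmbeddingOn H (imageOn H T g hg) T g := by
  refine ⟨hg, fun x hx y hy => ⟨?_, fun h => ⟨x, hx, y, hy, rfl, rfl, h⟩⟩⟩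
  rintro ⟨z, hz, w, hw, h1, h2, h3⟩
  rwa [hg hz hx h1, hg hw hy h2] at h3

/-- A `C`-free graph on a co-infinite set of vertices of `X`. -/
structure PartialGraph {W : Type v} (C : SimpleGraph W) (X : Type u) where
  /-- the set of vertices -/
  verts : Set X
  /-- a graph whose restriction to the vertices is the one meant -/
  graph : SimpleGraph X
  infinite_compl : vertsᶜ.Infinite
  free : C.Free (graph.induce verts)

namespace PartialGraph

variable {W : Type v} {C : SimpleGraph W} {X : Type u}

instance : Preorder (PartialGraph C X) where
  le p q := p.verts ⊆ q.verts ∧ ∀ x ∈ p.verts, ∀ y ∈ p.verts, (p.graph.Adj x y ↔ q.graph.Adj x y)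
  le_refl p := ⟨subset_rfl, fun _ _ _ _ => Iff.rfl⟩
  le_trans p q r h₁ h₂ := ⟨h₁.1.trans h₂.1, fun x hx y hy =>
    (h₁.2 x hx y hy).trans (h₂.2 x (h₁.1 hx) y (h₁.1 hy))⟩

/-- A tuple of vertices and a pattern which one may try to realize over it. -/
abbrev Task (X : Type u) := Σ mk : ℕ × ℕ, (Fin mk.1 → X) × Pattern (Fin mk.1 ⊕ Fin mk.2)

/-- `p` contains the tuple and a tuple over it with the given pattern. -/
def Realizes (p : PartialGraph C X) (t : Task X) : Prop :=
  (∀ i, t.2.1 i ∈ p.verts) ∧ ∃ y : Fin t.1.2 → X, (∀ j, y j ∈ p.verts) ∧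
    pattern p.graph (Sum.elim t.2.1 y) = t.2.2

lemma exists_decides (p : PartialGraph C X) (t : Task X) :
    ∃ q, p ≤ q ∧ (q.Realizes t ∨ ∀ r, q ≤ r → ¬ r.Realizes t) := by
  by_cases h : ∃ q, p ≤ q ∧ q.Realizes t
  · obtain ⟨q, h1, h2⟩ := h
    exact ⟨q, h1, Or.inl h2⟩
  · exact ⟨p, le_rfl, Or.inr fun r h1 h2 => h ⟨r, h1, h2⟩⟩

/-- There are countably many tasks, and decisions persist: each is either realized or made
impossible for all further extensions at some stage. -/
lemma exists_generic [Countable X] (p : PartialGraph C X) : ∃ f : ℕ → PartialGraph C X,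
    f 0 = p ∧ Monotone f ∧
      ∀ t : Task X, ∃ s, (f s).Realizes t ∨ ∀ r, f s ≤ r → ¬ r.Realizes t := by
  choose g hle hdec using exists_decides (C := C) (X := X)
  have : Nonempty (Task X) := ⟨⟨(0, 0), Fin.elim0, fun _ _ => True, fun _ _ => True⟩⟩
  obtain ⟨τ, hτ⟩ := exists_surjective_nat (Task X)
  let f : ℕ → PartialGraph C X := fun s => Nat.rec p (fun s q => g q (τ s)) s
  refine ⟨f, rfl, monotone_nat_of_le_succ fun s => hle (f s) (τ s), fun t => ?_⟩
  obtain ⟨s, rfl⟩ := hτ t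
  exact ⟨s + 1, hdec (f s) (τ s)⟩

/-- The union of an increasing sequence. -/
def limit (f : ℕ → PartialGraph C X) : SimpleGraph (⋃ s, (f s).verts) where
  Adj x y := ∃ s, x.1 ∈ (f s).verts ∧ y.1 ∈ (f s).verts ∧ (f s).graph.Adj x y
  symm := ⟨fun _ _ ⟨s, h1, h2, h3⟩ => ⟨s, h2, h1, h3.symm⟩⟩
  loopless := ⟨fun _ ⟨_, _, _, h3⟩ => h3.ne rfl⟩

variable {f : ℕ → PartialGraph C X} (hf : Monotone f)
include hf

lemma limit_adj_iff {x y : ⋃ s, (f s).verts} {s : ℕ} (hx : x.1 ∈ (f s).verts)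
    (hy : y.1 ∈ (f s).verts) : (limit f).Adj x y ↔ (f s).graph.Adj x y := by
  constructor
  · rintro ⟨r, hx', hy', h⟩
    rcases le_total r s with hrs | hrs
    · exact ((hf hrs).2 _ hx' _ hy').1 h
    · exact ((hf hrs).2 _ hx _ hy).2 h
  · exact fun h => ⟨s, hx, hy, h⟩

lemma exists_forall_mem {ι : Type*} [Finite ι] (a : ι → ⋃ s, (f s).verts) (N : ℕ) :
    ∃ s, N ≤ s ∧ ∀ i, (a i).1 ∈ (f s).verts := by
  have := Fintype.ofFinite ι
  have h : ∀ i, ∃ s, (a i).1 ∈ (f s).verts := fun i => Set.mem_iUnion.1 (a i).2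
  choose s hs using h
  refine ⟨N ⊔ Finset.univ.sup s, le_sup_left, fun i => (hf ?_).1 (hs i)⟩
  exact (Finset.le_sup (Finset.mem_univ i)).trans le_sup_right

lemma limit_free [Finite W] : C.Free (limit f) := by
  rintro ⟨c⟩
  obtain ⟨s, -, hs⟩ := exists_forall_mem hf c 0
  refine (f s).free ⟨⟨⟨fun w => ⟨c w, hs w⟩, fun {a b} hab => ?_⟩, fun a b hab => ?_⟩⟩
  · exact (limit_adj_iff hf (hs a) (hs b)).1 (c.toHom.map_adj hab)
  · have h1 := congrArg Subtype.val hab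
    exact c.injective (Subtype.ext h1)

/-- Transport to `X` the part of `H` made of the current stage and of `y`: the stage stays in place,
and the finitely many new vertices have room in its infinite complement. -/
lemma exists_realizes_of_embedding [Nonempty X] {V' : Type*} {H : SimpleGraph V'}
    (e : limit f ↪g H)
    (hH : C.Free H) {m k : ℕ} (a : Fin m → ⋃ s, (f s).verts) (y : Fin k → V') {s : ℕ}
    (hs : ∀ i, (a i).1 ∈ (f s).verts) :
    ∃ r, f s ≤ r ∧ r.Realizes ⟨(m, k), fun i => a i, pattern H (Sum.elim (e ∘ a) y)⟩ := by
  classical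
  have hinf : (f s).vertsᶜ.encard = ⊤ := (f s).infinite_compl.encard_eq
  obtain ⟨g₀, hg₀, hinj₀⟩ := (Set.finite_range y).exists_injOn_of_encard_le
    (t := (f s).vertsᶜ) (by rw [hinf]; exact le_top)
  let old : Set (⋃ s, (f s).verts) := {x | x.1 ∈ (f s).verts}
  let g : V' → X := fun z => if h : ∃ x ∈ old, e x = z then (h.choose : X) else g₀ z
  have g_old : ∀ x ∈ old, g (e x) = x := by
    intro x hx
    have h : ∃ x' ∈ old, e x' = e x := ⟨x, hx, rfl⟩
    simp only [g, dif_pos h]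
    rw [e.injective h.choose_spec.2]
  have g_new : ∀ z, z ∉ e '' old → g z = g₀ z := fun z hz => dif_neg hz
  let T : Set V' := e '' old ∪ Set.range y
  have g_mem : ∀ z ∈ T, z ∉ e '' old → g z ∉ (f s).verts := by
    intro z hz hz'
    rw [g_new z hz']
    exact hg₀ (hz.resolve_left hz')
  have g_inj : Set.InjOn g T := by
    intro z hz w hw hzw
    by_cases h1 : z ∈ e '' old <;> by_cases h2 : w ∈ e '' old
    · obtain ⟨x, hx, rfl⟩ := h1
      obtain ⟨x', hx', rfl⟩ := h2
      rw [g_old x hx, g_old x' hx'] at hzw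
      rw [Subtype.ext hzw]
    · obtain ⟨x, hx, rfl⟩ := h1
      refine absurd ?_ (g_mem w hw h2)
      rw [← hzw, g_old x hx]
      exact hx
    · obtain ⟨x, hx, rfl⟩ := h2
      refine absurd ?_ (g_mem z hz h1)
      rw [hzw, g_old x hx]
      exact hx
    · rw [g_new z h1, g_new w h2] at hzw
      exact hinj₀ (hz.resolve_left h1) (hw.resolve_left h2) hzw
  have hemb := isEmbeddingOn_imageOn H T g g_inj
  have hT : ∀ x (hx : x ∈ (f s).verts), ∃ z, ∃ hz : e z ∈ T, z.1 = x ∧ g (e z) = x := by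
    intro x hx
    have hx' : (⟨x, Set.mem_iUnion.2 ⟨s, hx⟩⟩ : ⋃ s, (f s).verts) ∈ old := hx
    exact ⟨_, Or.inl ⟨_, hx', rfl⟩, rfl, g_old _ hx'⟩
  let r : PartialGraph C X := {
    verts := g '' T
    graph := imageOn H T g g_inj
    infinite_compl := by
      refine ((f s).infinite_compl.sdiff ((Set.finite_range y).image g)).mono ?_
      rintro x ⟨hx, hx'⟩ ⟨z, hz | hz, rfl⟩
      · obtain ⟨w, hw, rfl⟩ := hz
        rw [g_old w hw] at hx
        exact hx hw
      · exact hx' ⟨z, hz, rfl⟩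
    free := free_induce_image hH hemb }
  have haT : ∀ i, e (a i) ∈ T := fun i => Or.inl ⟨a i, hs i, rfl⟩
  refine ⟨r, ⟨fun x hx => ?_, fun x hx x' hx' => ?_⟩, fun i => ?_, fun j => g (y j), fun j => ?_, ?_⟩
  · obtain ⟨z, hz, -, hzx⟩ := hT x hx
    exact ⟨e z, hz, hzx⟩
  · obtain ⟨z, hz, rfl, hzx⟩ := hT x hx
    obtain ⟨z', hz', rfl, hzx'⟩ := hT x' hx'
    rw [← limit_adj_iff hf hx hx', ← e.map_adj_iff, ← hemb.2 _ hz _ hz', hzx, hzx']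
  · exact ⟨e (a i), haT i, g_old _ (hs i)⟩
  · exact ⟨y j, Or.inr ⟨j, rfl⟩, rfl⟩
  · have h1 := hemb.pattern_eq (s := Sum.elim (e ∘ a) y) (by
      rintro (i | j)
      · exact haT i
      · exact Or.inr ⟨j, rfl⟩)
    rw [← h1]
    congr 1
    funext i
    rcases i with i | j
    · exact (g_old _ (hs i)).symm
    · rfl

/-- A task arising from an extension of the limit can never have been refused, since every stage
containing its parameters still has an extension realizing it. -/
lemma hasFiniteRetractions_limit [Nonempty X]
    (hgen : ∀ t : Task X, ∃ s, (f s).Realizes t ∨ ∀ r, f s ≤ r → ¬ r.Realizes t) :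
    HasFiniteRetractions C (limit f) := by
  intro V' H e hH S hS
  rcases isEmpty_or_nonempty V' with hV' | ⟨⟨x₀⟩⟩
  · exact ⟨fun x => isEmptyElim x, ⟨fun x => isEmptyElim x, fun x => isEmptyElim x⟩,
      fun a => isEmptyElim (e a)⟩
  obtain ⟨k, y, hy⟩ := (hS.insert x₀).exists_fin_range_eq
  obtain ⟨m, a, ha⟩ := ((hS.preimage e.injective.injOn) : (e ⁻¹' S).Finite).exists_fin_range_eq
  obtain ⟨s, hs | hs⟩ := hgen ⟨(m, k), fun i => a i, pattern H (Sum.elim (e ∘ a) y)⟩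
  · obtain ⟨has, y', hy's, hpat⟩ := hs
    let y'' : Fin k → ⋃ s, (f s).verts := fun j => ⟨y' j, Set.mem_iUnion.2 ⟨s, hy's j⟩⟩
    have hpat' : pattern (limit f) (Sum.elim a y'') = pattern H (Sum.elim (e ∘ a) y) := by
      refine Eq.trans ?_ hpat
      rw [pattern_eq_iff]
      dsimp only
      have hval : ∀ i, (Sum.elim a y'' i).1 = Sum.elim (fun i => (a i).1) y' i := by
        rintro (i | i) <;> rfl
      have hmem : ∀ i, (Sum.elim a y'' i).1 ∈ (f s).verts := by
        rintro (i | i)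
        exacts [has i, hy's i]
      intro i j
      refine ⟨?_, ?_⟩
      · rw [Subtype.ext_iff, hval, hval]
      · rw [limit_adj_iff hf (hmem i) (hmem j), hval, hval]
    have : ∃ i, y i = x₀ := by
      have : x₀ ∈ Set.range y := hy ▸ Set.mem_insert _ _
      exact this
    obtain ⟨i₀, -⟩ := this
    have : Nonempty (⋃ s, (f s).verts) := ⟨y'' i₀⟩
    obtain ⟨h, hh, hval⟩ := exists_isEmbeddingOn_of_pattern_eq hpat'
    refine ⟨h, hh.mono ?_, fun b hb => ?_⟩
    · intro x hx
      have : x ∈ Set.range y := hy ▸ Set.mem_insert_of_mem _ hx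
      obtain ⟨i, rfl⟩ := this
      exact ⟨Sum.inr i, rfl⟩
    · have : b ∈ Set.range a := ha ▸ hb
      obtain ⟨i, rfl⟩ := this
      exact hval (Sum.inl i)
  · obtain ⟨s', hss', has⟩ := exists_forall_mem hf a s
    obtain ⟨r, hr, hreal⟩ := exists_realizes_of_embedding hf e hH.2 a y has
    exact absurd hreal (hs r ((hf hss').trans hr))

end PartialGraph

/-- Every graph of `𝒢_C` is an induced subgraph of an existentially complete one. -/
theorem exists_isExistentiallyComplete_embedding {W : Type v} [Finite W] {C : SimpleGraph W}
    {V : Type u} {G : SimpleGraph V} (hG : IsCountableFree C G) :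
    ∃ (V' : Type u) (H : SimpleGraph V'), IsExistentiallyComplete C H ∧ Nonempty (G ↪g H) := by
  have := hG.1
  -- The summand `ℕ` supplies the infinite supply of unused vertices.
  let inj : V → V ⊕ ℕ := Sum.inl
  have hinj : Set.InjOn inj Set.univ := Sum.inl_injective.injOn
  have hemb := isEmbeddingOn_imageOn G Set.univ inj hinj
  let p : PartialGraph C (V ⊕ ℕ) := {
    verts := inj '' Set.univ
    graph := imageOn G Set.univ inj hinj
    infinite_compl := by
      refine (Set.infinite_range_of_injective (f := (Sum.inr : ℕ → V ⊕ ℕ))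
        Sum.inr_injective).mono ?_
      rintro _ ⟨i, rfl⟩ ⟨v, -, h⟩
      cases h
    free := free_induce_image hG.2 hemb }
  obtain ⟨f, hf0, hf, hgen⟩ := p.exists_generic
  have hmem : ∀ v, inj v ∈ (f 0).verts := by
    rw [hf0]
    exact fun v => ⟨v, trivial, rfl⟩
  have hfree : IsCountableFree C (PartialGraph.limit f) :=
    ⟨inferInstance, PartialGraph.limit_free hf⟩
  refine ⟨_, PartialGraph.limit f,
    (PartialGraph.hasFiniteRetractions_limit hf hgen).isExistentiallyComplete hfree,
    ⟨⟨⟨fun v => ⟨inj v, Set.mem_iUnion.2 ⟨0, hmem v⟩⟩, fun a b h => ?_⟩, fun {a b} => ?_⟩⟩⟩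
  · exact Sum.inl_injective (Subtype.ext_iff.1 h)
  · refine (PartialGraph.limit_adj_iff hf (hmem a) (hmem b)).trans ?_
    rw [hf0]
    exact hemb.2 a trivial b trivial

end Extension

/-! ### Finite reflection by an ultrapower. -/

section Ultrapower

open Filter

/-- The ultrapower of a graph. -/
def germGraph {α V : Type*} (l : Ultrafilter α) (G : SimpleGraph V) :
    SimpleGraph (Germ (l : Filter α) V) where
  Adj := Germ.LiftRel G.Adj
  symm := ⟨fun x y => Germ.inductionOn₂ x y fun f g h => by
    rw [Germ.liftRel_coe] at h ⊢
    exact h.mono fun _ h => h.symm⟩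
  loopless := ⟨fun x => Germ.inductionOn x fun f h => by
    rw [Germ.liftRel_coe] at h
    obtain ⟨_, h⟩ := h.exists
    exact h.ne rfl⟩

lemma eventually_iff_eventually {α : Type*} (l : Ultrafilter α) (P : α → Prop) :
    ∀ᶠ x in l, (P x ↔ ∀ᶠ y in l, P y) := by
  by_cases h : ∀ᶠ y in l, P y
  · exact h.mono fun x hx => ⟨fun _ => h, fun _ => hx⟩
  · exact (Ultrafilter.eventually_not.2 h).mono fun x hx => iff_of_false hx h

/-- The theorem of Łoś for finite atomic diagrams. -/
lemma eventually_pattern_eq {α V ι : Type*} [Finite ι] (l : Ultrafilter α) (G : SimpleGraph V)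
    (s : ι → α → V) : ∀ᶠ x in l,
      pattern G (fun i => s i x) =
        pattern (germGraph l G) (fun i => (s i : Germ (l : Filter α) V)) := by
  simp only [pattern_eq_iff]
  rw [eventually_all]
  intro i
  rw [eventually_all]
  intro j
  refine (eventually_iff_eventually l fun x => s i x = s j x).and
    (eventually_iff_eventually l fun x => G.Adj (s i x) (s j x)) |>.mono fun x hx => ⟨?_, ?_⟩
  · rw [Germ.coe_eq]
    exact hx.1
  · exact hx.2

lemma free_germGraph {α V : Type*} {W : Type*} [Finite W] {C : SimpleGraph W} (l : Ultrafilter α)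
    {G : SimpleGraph V} (hG : C.Free G) : C.Free (germGraph l G) := by
  rintro ⟨c⟩
  have : ∀ w, ∃ s : α → V, (s : Germ (l : Filter α) V) = c w :=
    fun w => Germ.inductionOn (c w) fun s => ⟨s, rfl⟩
  choose s hs using this
  obtain ⟨x, hx⟩ := (eventually_pattern_eq l G s).exists
  rw [pattern_eq_iff] at hx
  refine hG ⟨⟨⟨fun w => s w x, fun {a b} hab => ?_⟩, fun a b hab => ?_⟩⟩
  · refine (hx a b).2.2 ?_
    rw [hs, hs]
    exact c.toHom.map_adj hab
  · have := (hx a b).1.1 hab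
    rw [hs, hs] at this
    exact c.injective this

/-- Over a finite set of vertices of an existentially complete graph, the patterns of the tuples of
any other graph of the class containing a large enough finite part of it are already realized. -/
lemma HasFiniteRetractions.exists_finset_reflecting {W : Type v} [Finite W] {C : SimpleGraph W}
    {V₁ V₂ : Type u} {G₁ : SimpleGraph V₁} {G₂ : SimpleGraph V₂} [Countable V₁]
    (h₁ : HasFiniteRetractions C G₁) (h₂ : C.Free G₂) (A : Finset V₁) (k : ℕ) :
    ∃ F : Finset V₁, A ⊆ F ∧ ∀ g : V₁ → V₂, IsEmbeddingOn G₁ G₂ F g → ∀ y : Fin k → V₂,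
      ∃ y' : Fin k → V₁,
        pattern G₁ (Sum.elim (fun a : A => a.1) y') =
          pattern G₂ (Sum.elim (fun a : A => g a) y) := by
  classical
  by_contra! hcon
  have hcon' : ∀ F : Finset V₁, ∃ g : V₁ → V₂, IsEmbeddingOn G₁ G₂ ↑(F ∪ A) g ∧
      ∃ y : Fin k → V₂, ∀ y' : Fin k → V₁, pattern G₁ (Sum.elim (fun a : A => a.1) y') ≠
        pattern G₂ (Sum.elim (fun a : A => g a) y) :=
    fun F => hcon (F ∪ A) Finset.subset_union_right
  choose g hg y hy using hcon'
  -- Refining `atTop` makes each vertex of `G₁` belong to almost every `F`, so the failing maps `g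
  -- F` together embed `G₁` in the ultrapower of `G₂`.
  let l : Ultrafilter (Finset V₁) := Ultrafilter.of atTop
  have hl : (l : Filter (Finset V₁)) ≤ atTop := Ultrafilter.of_le atTop
  have hev : ∀ v w : V₁, ∀ᶠ F in (l : Filter (Finset V₁)), v ∈ F ∧ w ∈ F := by
    intro v w
    refine hl ((eventually_ge_atTop {v, w}).mono fun F hF => ⟨hF ?_, hF ?_⟩) <;> simp
  let Γ := germGraph l G₂
  let ge : V₁ → Germ (l : Filter (Finset V₁)) V₂ := fun v => ((fun F => g F v) : Finset V₁ → V₂)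
  let ye : Fin k → Germ (l : Filter (Finset V₁)) V₂ := fun j => ((fun F => y F j) : Finset V₁ → V₂)
  have ge_inj : Function.Injective ge := by
    intro v w hvw
    rw [Germ.coe_eq] at hvw
    obtain ⟨F, h1, h2⟩ := (hvw.and (hev v w)).exists
    exact (hg F).1 (by simp [h2.1]) (by simp [h2.2]) h1
  have ge_adj : ∀ v w, Γ.Adj (ge v) (ge w) ↔ G₁.Adj v w := by
    intro v w
    have h1 : ∀ᶠ F in (l : Filter (Finset V₁)), (G₂.Adj (g F v) (g F w) ↔ G₁.Adj v w) :=
      (hev v w).mono fun F hF => (hg F).2 v (by simp [hF.1]) w (by simp [hF.2])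
    constructor
    · intro h
      obtain ⟨F, h2, h3⟩ := (h1.and (show ∀ᶠ F in (l : Filter (Finset V₁)),
        G₂.Adj (g F v) (g F w) from h)).exists
      exact h2.1 h3
    · intro h
      exact h1.mono fun F hF => hF.2 h
  -- Retractions are available only for countable graphs, so the ultrapower is cut down to `G₁` and
  -- the failing tuple.
  let S : Set (Germ (l : Filter (Finset V₁)) V₂) := Set.range ge ∪ Set.range ye
  have hS : Countable S :=
    ((Set.countable_range ge).union (Set.countable_range ye)).to_subtype
  let e : G₁ ↪g Γ.induce S :=
    ⟨⟨fun v => ⟨ge v, Or.inl ⟨v, rfl⟩⟩, fun v w h => ge_inj (Subtype.ext_iff.1 h)⟩,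
      fun {v w} => ge_adj v w⟩
  have hfree : C.Free (Γ.induce S) := fun h =>
    free_germGraph l h₂ (h.trans ⟨(SimpleGraph.Embedding.induce S).toCopy⟩)
  let ys : Fin k → S := fun j => ⟨ye j, Or.inr ⟨j, rfl⟩⟩
  obtain ⟨h, hh, hfix⟩ := h₁ S (Γ.induce S) e ⟨hS, hfree⟩ (e '' A ∪ Set.range ys)
    ((A.finite_toSet.image e).union (Set.finite_range ys))
  have hpat := hh.pattern_eq (s := Sum.elim (fun a : A => e a.1) ys) (by
    rintro (a | j)
    · exact Or.inl ⟨a, a.2, rfl⟩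
    · exact Or.inr ⟨j, rfl⟩)
  have hcomp : h ∘ Sum.elim (fun a : A => e a.1) ys = Sum.elim (fun a : A => a.1) (h ∘ ys) := by
    funext i
    rcases i with a | j
    · exact hfix a.1 (Or.inl ⟨a.1, a.2, rfl⟩)
    · rfl
  rw [hcomp, ← pattern_embedding (SimpleGraph.Embedding.induce S)] at hpat
  obtain ⟨F, hF⟩ := (eventually_pattern_eq l G₂
    (Sum.elim (fun (a : A) F => g F a.1) (fun j F => y F j))).exists
  refine hy F (h ∘ ys) (hpat.trans (Eq.trans ?_ (hF.symm.trans ?_)))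
  · congr 1
    funext i
    rcases i with a | j <;> rfl
  · congr 1
    funext i
    rcases i with a | j <;> rfl

end Ultrapower

/-! ### Uniqueness of the existentially complete graph. -/

section BackAndForth

lemma exists_iso_of_back_and_forth {V₁ V₂ : Type*} [Countable V₁] [Countable V₂] [Nonempty V₁]
    [Nonempty V₂] {G₁ : SimpleGraph V₁} {G₂ : SimpleGraph V₂} (R : Finset (V₁ × V₂) → Prop)
    (h₀ : R ∅) (hR : ∀ p, R p → IsPartialIso G₁ G₂ (p : Set (V₁ × V₂)))
    (forth : ∀ p, R p → ∀ a, ∃ q, R q ∧ p ⊆ q ∧ ∃ b, (a, b) ∈ q)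
    (back : ∀ p, R p → ∀ b, ∃ q, R q ∧ p ⊆ q ∧ ∃ a, (a, b) ∈ q) : Nonempty (G₁ ≃g G₂) := by
  obtain ⟨α, hα⟩ := exists_surjective_nat V₁
  obtain ⟨β, hβ⟩ := exists_surjective_nat V₂
  have step : ∀ (p : {p // R p}) (s : ℕ), ∃ q : {p // R p}, p ≤ q ∧
      (∃ b, (α s, b) ∈ q.1) ∧ ∃ a, (a, β s) ∈ q.1 := by
    rintro ⟨p, hp⟩ s
    obtain ⟨q, hq, hpq, b, hb⟩ := forth p hp (α s)
    obtain ⟨r, hr, hqr, a, ha⟩ := back q hq (β s)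
    exact ⟨⟨r, hr⟩, hpq.trans hqr, ⟨b, hqr hb⟩, ⟨a, ha⟩⟩
  choose next hle hα' hβ' using step
  let f : ℕ → {p // R p} := fun s => Nat.rec ⟨∅, h₀⟩ (fun s p => next p s) s
  have hf : Monotone f := monotone_nat_of_le_succ fun s => hle (f s) s
  have hdom : ∀ a, ∃ b s, (a, b) ∈ (f s).1 := by
    intro a
    obtain ⟨s, rfl⟩ := hα a
    obtain ⟨b, hb⟩ := hα' (f s) s
    exact ⟨b, s + 1, hb⟩
  have hran : ∀ b, ∃ a s, (a, b) ∈ (f s).1 := by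
    intro b
    obtain ⟨s, rfl⟩ := hβ b
    obtain ⟨a, ha⟩ := hβ' (f s) s
    exact ⟨a, s + 1, ha⟩
  have hcommon : ∀ x y : V₁ × V₂, (∃ s, x ∈ (f s).1) → (∃ s, y ∈ (f s).1) →
      (x.1 = y.1 ↔ x.2 = y.2) ∧ (G₁.Adj x.1 y.1 ↔ G₂.Adj x.2 y.2) := by
    rintro x y ⟨s, hx⟩ ⟨t, hy⟩
    have hx' := hf (le_max_left s t) hx
    have hy' := hf (le_max_right s t) hy
    have := hR _ (f (max s t)).2
    exact ⟨this.eq_iff x hx' y hy', this.adj_iff x hx' y hy'⟩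
  choose φ hφ using hdom
  have hinj : Function.Injective φ := fun a b hab => (hcommon _ _ (hφ a) (hφ b)).1.2 hab
  have hsurj : Function.Surjective φ := by
    intro b
    obtain ⟨a, ha⟩ := hran b
    exact ⟨a, (hcommon _ _ (hφ a) ha).1.1 rfl⟩
  exact ⟨⟨Equiv.ofBijective φ ⟨hinj, hsurj⟩, fun {a b} => (hcommon _ _ (hφ a) (hφ b)).2.symm⟩⟩

lemma _root_.Finset.exists_fin_subset_range {α : Type*} [Nonempty α] (Y : Finset α) {k : ℕ}
    (hk : Y.card ≤ k) : ∃ y : Fin k → α, ∀ a ∈ Y, ∃ i, y i = a := by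
  classical
  refine ⟨fun i => if h : i.1 < Y.card then Y.equivFin.symm ⟨i, h⟩ else Classical.arbitrary α,
    fun a ha => ⟨(Y.equivFin ⟨a, ha⟩).castLE hk, ?_⟩⟩
  simp

variable {n : ℕ} {V₁ V₂ : Type u} {G₁ : SimpleGraph V₁} {G₂ : SimpleGraph V₂}

/-- An embedding on such an `F` sends kernels inside `A` to kernels. -/
lemma exists_finset_kernel_witnesses (G : SimpleGraph V₁) (n : ℕ) (A : Finset V₁) :
    ∃ F : Finset V₁, A ⊆ F ∧ ∀ B ⊆ A, IsKernel G n B → ∃ x ∈ F, ∃ y ∈ F, x ≠ y ∧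
      (∀ v ∈ B, G.Adj x v) ∧ ∀ v ∈ B, G.Adj y v := by
  classical
  have : ∀ B : Finset V₁, ∃ E : Finset V₁, IsKernel G n B → ∃ x ∈ E, ∃ y ∈ E, x ≠ y ∧
      (∀ v ∈ B, G.Adj x v) ∧ ∀ v ∈ B, G.Adj y v := by
    intro B
    by_cases hB : IsKernel G n B
    · obtain ⟨-, -, x, y, hxy, hx, hy⟩ := hB
      exact ⟨{x, y}, fun _ => ⟨x, by simp, y, by simp, hxy, hx, hy⟩⟩
    · exact ⟨∅, fun h => absurd h hB⟩
  choose E hE using this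
  refine ⟨A ∪ A.powerset.biUnion E, Finset.subset_union_left, fun B hBA hB => ?_⟩
  obtain ⟨x, hx, y, hy, h⟩ := hE B hB
  have hsub : E B ⊆ A ∪ A.powerset.biUnion E :=
    (Finset.subset_biUnion_of_mem E (Finset.mem_powerset.2 hBA)).trans Finset.subset_union_right
  exact ⟨x, hsub hx, y, hsub hy, h⟩

lemma isClosedPartialIso_empty (hn : 3 ≤ n) : IsClosedPartialIso n G₁ G₂ ∅ where
  eq_iff := by simp
  adj_iff := by simp
  left := by simp
  right := by simp
  isKernel_iff B D hB hD := by
    have h1 : B = ∅ := Finset.eq_empty_of_forall_notMem fun b hb => by simpa using hB b hb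
    have h2 : D = ∅ := Finset.eq_empty_of_forall_notMem fun b hb => by simpa using hD b hb
    subst h1 h2
    constructor <;> rintro ⟨-, h, -⟩ <;> simp at h <;> omega

/-- The maps `h` pull special sets of `G₂` near `g '' A` back to `G₁`, where `A` is closed. The
bound `n + 1` covers a kernel with its two witnesses. If the preimage of an isolated clique is not
inside `a*`, it contains a kernel in `A`, whose image would be a kernel inside the isolated clique.
-/
lemma isClosedPartialIso_graph (hn : 3 ≤ n) (h₁ : CliqueTriangleFree n G₁) {A F : Finset V₁}
    (hA : ∀ a ∈ A, star G₁ n a ⊆ A) (hAF : A ⊆ F)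
    (hF : ∀ B ⊆ A, IsKernel G₁ n B → ∃ x ∈ F, ∃ y ∈ F, x ≠ y ∧
      (∀ v ∈ B, G₁.Adj x v) ∧ ∀ v ∈ B, G₁.Adj y v) {g : V₁ → V₂} (hg : IsEmbeddingOn G₁ G₂ F g)
    (href : ∀ Y : Finset V₂, Y.card ≤ n + 1 → ∃ h : V₂ → V₁,
      IsEmbeddingOn G₂ G₁ (g '' F ∪ Y) h ∧ ∀ a ∈ F, h (g a) = a) :
    IsClosedPartialIso n G₁ G₂ ((fun a => (a, g a)) '' A) := by
  classical
  have hker : ∀ B ⊆ A, IsKernel G₁ n B → IsKernel G₂ n (B.image g) := by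
    intro B hBA hB
    obtain ⟨x, hxF, y, hyF, hxy, hx, hy⟩ := hF B hBA hB
    exact hg.isKernel_image hB.1 hB.2.1 (by exact_mod_cast hBA.trans hAF) hxy hxF hyF hx hy
  refine ⟨⟨?_, ?_⟩, ?_, ?_, ?_⟩
  · rintro _ ⟨x, hx, rfl⟩ _ ⟨y, hy, rfl⟩
    exact ⟨fun h => congrArg g h, fun h => hg.1 (hAF hx) (hAF hy) h⟩
  · rintro _ ⟨x, hx, rfl⟩ _ ⟨y, hy, rfl⟩
    exact (hg.2 _ (hAF hx) _ (hAF hy)).symm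
  · rintro _ ⟨x, hx, rfl⟩ a ha
    exact ⟨g a, a, hA x hx ha, rfl⟩
  · rintro _ ⟨a, ha, rfl⟩ b ⟨B, hB, hclq, hb⟩
    rcases isSpecial_iff.1 hB with hB | ⟨hcl, hc, x, y, hxy, hx, hy⟩
    · have haB : g a ∈ B := hB.mem_of_isClique_insert hn hclq
      obtain ⟨h, hh, hfix⟩ := href B (by rw [hB.1.card_eq]; omega)
      have hQ : G₁.IsNClique n (B.image h) := hh.isNClique_image hB.1 Set.subset_union_right
      have haQ : a ∈ B.image h := Finset.mem_image.2 ⟨g a, haB, hfix a (hAF ha)⟩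
      have hback : ∀ z ∈ B, h z ∈ A → g (h z) = z := fun z hz hzA =>
        hh.1 (Or.inl ⟨_, hAF hzA, rfl⟩) (Or.inr hz) (hfix _ (hAF hzA))
      have hsub : (B.image h : Set V₁) ⊆ star G₁ n a := by
        by_contra hsub
        obtain ⟨D, hDQ, hD, hDs⟩ := h₁.exists_isKernel_of_not_subset_star hn hQ haQ hsub
        have hDA : D ⊆ A := fun c hc => hA a ha (hDs hc)
        refine hB.not_isKernel_subset hn (hker D hDA hD) fun z hz => ?_
        obtain ⟨c, hc, rfl⟩ := Finset.mem_image.1 hz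
        obtain ⟨w, hw, rfl⟩ := Finset.mem_image.1 (hDQ hc)
        rwa [hback w hw (hDA hc)]
      have hbA : h b ∈ A := hA a ha (hsub (Finset.mem_image_of_mem h hb))
      exact ⟨h b, h b, hbA, Prod.ext rfl (hback b hb hbA)⟩
    · obtain ⟨h, hh, hfix⟩ := href (insert x (insert y B)) (by
        refine (Finset.card_insert_le _ _).trans ?_
        have := Finset.card_insert_le y B
        omega)
      have hBS : (B : Set V₂) ⊆ g '' F ∪ ↑(insert x (insert y B)) := fun z hz =>
        Or.inr (by simp [Finset.mem_coe.1 hz])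
      have hK := hh.isKernel_image hcl hc hBS hxy (Or.inr (by simp)) (Or.inr (by simp)) hx hy
      have hclq' := hh.isClique_image hclq (Set.insert_subset (Or.inl ⟨a, hAF ha, rfl⟩) hBS)
      rw [Set.image_insert_eq, hfix a (hAF ha)] at hclq'
      have hbA : h b ∈ A := hA a ha ⟨B.image h, isSpecial_iff.2 (Or.inr hK),
        by rwa [Finset.coe_image], Finset.mem_image_of_mem h hb⟩
      exact ⟨h b, h b, hbA, Prod.ext rfl
        (hh.1 (Or.inl ⟨_, hAF hbA, rfl⟩) (hBS hb) (hfix _ (hAF hbA)))⟩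
  · intro B D hB hD
    have hBA : B ⊆ A := by
      intro b hb
      obtain ⟨d, -, c, hc, ⟨⟩⟩ := hB b hb
      exact hc
    have hDB : D = B.image g := by
      ext d
      rw [Finset.mem_image]
      constructor
      · intro hd
        obtain ⟨b, hb, c, -, ⟨⟩⟩ := hD d hd
        exact ⟨b, hb, rfl⟩
      · rintro ⟨b, hb, rfl⟩
        obtain ⟨d, hd, c, -, ⟨⟩⟩ := hB b hb
        exact hd
    subst hDB
    refine ⟨hker B hBA, ?_⟩
    rintro ⟨hcl, hc, x, y, hxy, hx, hy⟩
    obtain ⟨h, hh, hfix⟩ := href {x, y} (Finset.card_le_two.trans (by omega))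
    have := hh.isKernel_image hcl hc (by
      rw [Finset.coe_image]
      exact fun z hz => Or.inl (Set.image_mono (by exact_mod_cast hBA.trans hAF) hz)) hxy
      (Or.inr (by simp)) (Or.inr (by simp)) hx hy
    have himg : (B.image g).image h = B := by
      rw [Finset.image_image]
      exact (Finset.image_congr fun b hb => hfix b (hAF (hBA hb))).trans Finset.image_id
    rwa [himg] at this

/-- Retracting the free amalgam over `p` into `G₂` embeds a large finite part of `G₁` compatibly
with `p`. That part contains the closed set `A`, witnesses of its kernels, and enough vertices to
reflect `(n + 1)`-tuples of `G₂`, so the map on `A` is again a closed partial isomorphism. -/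
lemma IsClosedPartialIso.exists_extension (hn : 3 ≤ n)
    (h₁ : IsExistentiallyComplete (cliqueWithTriangle n) G₁)
    (h₂ : IsExistentiallyComplete (cliqueWithTriangle n) G₂) {p : Finset (V₁ × V₂)}
    (hp : IsClosedPartialIso n G₁ G₂ (p : Set (V₁ × V₂))) (b : V₁) :
    ∃ q : Finset (V₁ × V₂), IsClosedPartialIso n G₁ G₂ (q : Set (V₁ × V₂)) ∧ p ⊆ q ∧
      ∃ d, (b, d) ∈ q := by
  classical
  obtain ⟨hc₁, hf₁⟩ := (isCountableFree_iff hn).1 h₁.1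
  obtain ⟨hc₂, hf₂⟩ := (isCountableFree_iff hn).1 h₂.1
  have := h₁.nonempty
  have := h₂.nonempty
  let A : Finset V₁ := p.image Prod.fst ∪ insert b (hf₁.finite_star hn b).toFinset
  have hbA : b ∈ A := by simp [A]
  have hA : ∀ a ∈ A, star G₁ n a ⊆ A := by
    have hsb : star G₁ n b ⊆ A := by
      intro c hc
      simp [A, hc]
    intro a ha
    simp only [A, Finset.mem_union, Finset.mem_insert, Set.Finite.mem_toFinset] at ha
    rcases ha with ha | rfl | ha
    · obtain ⟨x, hx, rfl⟩ := Finset.mem_image.1 ha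
      intro c hc
      obtain ⟨d, hd⟩ := hp.left x hx c hc
      exact Finset.mem_coe.2 (Finset.mem_union_left _ (Finset.mem_image.2 ⟨_, hd, rfl⟩))
    · exact hsb
    · exact (hf₁.star_subset_of_mem hn ha).trans hsb
  obtain ⟨E, hAE, hE⟩ := exists_finset_kernel_witnesses G₁ n A
  obtain ⟨F, hEF, hF⟩ := h₁.hasFiniteRetractions.exists_finset_reflecting h₂.1.2 E (n + 1)
  obtain ⟨W, H, e₁, e₂, hH⟩ := hp.exists_isFreeAmalgam
  obtain ⟨h, hh, hfix⟩ := h₂.hasFiniteRetractions W H e₂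
    ((isCountableFree_iff hn).2 ⟨hH.countable, hH.cliqueTriangleFree hn hf₁ hf₂ hp⟩)
    (e₁ '' F ∪ e₂ '' (Prod.snd '' (p : Set (V₁ × V₂))))
    ((F.finite_toSet.image _).union ((p.finite_toSet.image _).image _))
  have hg : IsEmbeddingOn G₁ G₂ F (h ∘ e₁) := by
    refine ⟨fun x hx y hy e => ?_, fun x hx y hy => ?_⟩
    · exact e₁.injective (hh.1 (Or.inl ⟨x, hx, rfl⟩) (Or.inl ⟨y, hy, rfl⟩) e)
    · rw [← e₁.map_adj_iff (v := x)]
      exact hh.2 _ (Or.inl ⟨x, hx, rfl⟩) _ (Or.inl ⟨y, hy, rfl⟩)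
  have hgp : ∀ x ∈ p, h (e₁ x.1) = x.2 := by
    intro x hx
    rw [(hH.eq_iff x.1 x.2).2 hx]
    exact hfix _ (Or.inr ⟨_, ⟨x, hx, rfl⟩, rfl⟩)
  have hiso := isClosedPartialIso_graph hn hf₁ hA hAE hE (hg.mono (by exact_mod_cast hEF)) (by
    intro Y hY
    obtain ⟨y, hy⟩ := Y.exists_fin_subset_range hY
    obtain ⟨y', hy'⟩ := hF _ hg y
    obtain ⟨k, hk, hval⟩ := exists_isEmbeddingOn_of_pattern_eq hy'
    refine ⟨k, hk.mono ?_, fun a ha => hval (Sum.inl ⟨a, ha⟩)⟩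
    rintro _ (⟨a, ha, rfl⟩ | ha)
    · exact ⟨Sum.inl ⟨a, ha⟩, rfl⟩
    · obtain ⟨i, rfl⟩ := hy _ ha
      exact ⟨Sum.inr i, rfl⟩)
  refine ⟨A.image fun a => (a, (h ∘ e₁) a), by rwa [Finset.coe_image], fun x hx => ?_,
    h (e₁ b), Finset.mem_image.2 ⟨b, hbA, rfl⟩⟩
  refine Finset.mem_image.2 ⟨x.1, Finset.mem_union_left _ (Finset.mem_image_of_mem _ hx), ?_⟩
  exact Prod.ext rfl (hgp x hx)

/-- Existentially complete graphs are unique up to isomorphism. -/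
theorem IsExistentiallyComplete.nonempty_iso (hn : 3 ≤ n)
    (h₁ : IsExistentiallyComplete (cliqueWithTriangle n) G₁)
    (h₂ : IsExistentiallyComplete (cliqueWithTriangle n) G₂) : Nonempty (G₁ ≃g G₂) := by
  classical
  have := h₁.nonempty
  have := h₂.nonempty
  have := h₁.1.1
  have := h₂.1.1
  refine exists_iso_of_back_and_forth
    (fun p => IsClosedPartialIso n G₁ G₂ (p : Set (V₁ × V₂)))
    (by simpa using isClosedPartialIso_empty hn) (fun p hp => hp.toIsPartialIso)
    (fun p hp a => hp.exists_extension hn h₁ h₂ a) fun p hp b => ?_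
  have hsw : IsClosedPartialIso n G₂ G₁ (p.image Prod.swap : Finset (V₂ × V₁)) := by
    rw [Finset.coe_image, Set.image_swap_eq_preimage_swap]
    exact hp.symm
  obtain ⟨q, hq, hpq, a, ha⟩ := hsw.exists_extension hn h₂ h₁ b
  refine ⟨q.image Prod.swap, ?_, fun x hx => ?_, a, Finset.mem_image.2 ⟨_, ha, rfl⟩⟩
  · rw [Finset.coe_image, Set.image_swap_eq_preimage_swap]
    exact hq.symm
  · exact Finset.mem_image.2 ⟨x.swap, hpq (Finset.mem_image_of_mem _ hx), Prod.swap_swap x⟩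

end BackAndForth

/-! ### First-order axioms for existential completeness. -/

section Axiomatization

open Language

lemma exists_sentence_realize_iff {ι κ μ : Type} [Finite ι] [Finite κ] [Finite μ]
    (A : Set (Pattern (ι ⊕ μ))) (B : Set (Pattern (ι ⊕ κ))) :
    ∃ σ : Language.graph.Sentence, ∀ (V : Type u) (G : SimpleGraph V),
      @Sentence.Realize Language.graph V G.structure σ ↔
        ∀ x : ι → V, (∀ z : μ → V, pattern G (Sum.elim x z) ∈ A) →
          ∃ y : κ → V, pattern G (Sum.elim x y) ∈ B := by
  obtain ⟨θ, -, hθ⟩ := exists_isQF_realizes_iff.{u} A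
  obtain ⟨η, -, hη⟩ := exists_isQF_realizes_iff.{u} B
  let ψ : Language.graph.Formula ι := (θ.iAlls μ).imp (η.iExs κ)
  refine ⟨(ψ.relabel (Sum.inr : ι → Empty ⊕ ι)).iAlls ι, fun V G => ?_⟩
  let := G.structure
  have h1 : ∀ x, Realizes G ψ x ↔ ((∀ z : μ → V, Realizes G θ (Sum.elim x z)) →
      ∃ y : κ → V, Realizes G η (Sum.elim x y)) := by
    intro x
    simp only [ψ, Realizes, Formula.realize_imp, Formula.realize_iAlls, Formula.realize_iExs]
  have h2 : @Sentence.Realize Language.graph V G.structure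
      ((ψ.relabel (Sum.inr : ι → Empty ⊕ ι)).iAlls ι) ↔ ∀ x, Realizes G ψ x := by
    simp only [Sentence.Realize, Realizes, Formula.realize_iAlls, Formula.realize_relabel]
    exact Iff.rfl
  rw [h2]
  simp only [h1, hθ, hη]

variable {W : Type} {C : SimpleGraph W}

/-- The patterns of tuples `(x, z)` such that, in some `C`-free graph, there are such tuples and a
tuple `y` meeting `z` only in `x` for which `(x, y)` has the pattern `P`. -/
def compatiblePatterns (C : SimpleGraph W) {ι κ : Type} (P : Pattern (ι ⊕ κ)) :
    Set (Pattern (ι ⊕ W)) :=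
  {Q | ∃ (V : Type u) (K : SimpleGraph V) (x : ι → V) (y : κ → V) (z : W → V), C.Free K ∧
    pattern K (Sum.elim x y) = P ∧ pattern K (Sum.elim x z) = Q ∧
    ∀ j w, y j = z w → ∃ i, x i = z w}

/-- An extension `H` containing a realization of `P` itself witnesses compatibility for each `z` in
`G`: whatever `y` shares with `z` lies in `G` and is listed by `a`. -/
lemma hasFiniteRetractions_of_axioms {V : Type u} {G : SimpleGraph V}
    (h : ∀ (m k : ℕ) (P : Pattern (Fin m ⊕ Fin k)) (x : Fin m → V),
      (∀ z : W → V, pattern G (Sum.elim x z) ∈ compatiblePatterns.{u} C P) →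
        ∃ y : Fin k → V, pattern G (Sum.elim x y) = P) : HasFiniteRetractions C G := by
  intro V' H e hH S hS
  rcases isEmpty_or_nonempty V' with hV' | ⟨⟨x₀⟩⟩
  · exact ⟨fun x => isEmptyElim x, ⟨fun x => isEmptyElim x, fun x => isEmptyElim x⟩,
      fun a => isEmptyElim (e a)⟩
  have hS' := hS.insert x₀
  obtain ⟨k, y, hy⟩ := hS'.exists_fin_range_eq
  obtain ⟨m, a, ha⟩ :=
    ((hS'.preimage e.injective.injOn) : (e ⁻¹' (insert x₀ S)).Finite).exists_fin_range_eq
  obtain ⟨y', hy'⟩ := h m k (pattern H (Sum.elim (e ∘ a) y)) a (by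
    intro z
    refine ⟨V', H, e ∘ a, y, e ∘ z, hH.2, rfl, ?_, ?_⟩
    · rw [← pattern_embedding e (Sum.elim a z), Sum.comp_elim]
    · intro j w hjw
      have : z w ∈ Set.range a := by
        rw [ha, Set.mem_preimage, ← hy]
        exact ⟨j, hjw⟩
      obtain ⟨i, hi⟩ := this
      exact ⟨i, congrArg e hi⟩)
  have : ∃ i, y i = x₀ := by
    have : x₀ ∈ Set.range y := hy ▸ Set.mem_insert _ _
    exact this
  obtain ⟨i₀, -⟩ := this
  have : Nonempty V := ⟨y' i₀⟩
  obtain ⟨f, hf, hval⟩ := exists_isEmbeddingOn_of_pattern_eq hy'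
  refine ⟨f, hf.mono ?_, fun b hb => ?_⟩
  · intro x hx
    have : x ∈ Set.range y := hy ▸ Set.mem_insert_of_mem _ hx
    obtain ⟨i, rfl⟩ := this
    exact ⟨Sum.inr i, rfl⟩
  · have : b ∈ Set.range a := ha ▸ Set.mem_insert_of_mem _ hb
    obtain ⟨i, rfl⟩ := this
    exact hval (Sum.inl i)

/-- A copy of `C` meets `G` in at most as many vertices as `C` has; let `z` list them. In the
`C`-free graph `K` provided by compatibility, replace old vertices by the entries of `z'` and new
ones by entries of `y'`, to obtain a copy of `C` in `K`. -/
lemma free_of_isFreeAmalgam_of_compatible {V V₀ V' : Type u} [Nonempty V] {G : SimpleGraph V}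
    {K₀ : SimpleGraph V₀} {H : SimpleGraph V'} {ι κ : Type} {x : ι → V} {x₀ : ι → V₀}
    {y₀ : κ → V₀} {e₁ : G ↪g H} {e₂ : K₀ ↪g H}
    (hH : IsFreeAmalgam e₁ e₂ (Set.range fun i => (x i, x₀ i)))
    (hsurj : ∀ u, u ∈ Set.range x₀ ∨ u ∈ Set.range y₀)
    (hz : ∀ z : W → V, pattern G (Sum.elim x z) ∈
      compatiblePatterns.{u} C (pattern K₀ (Sum.elim x₀ y₀))) : C.Free H := by
  classical
  rintro ⟨c⟩
  let z : W → V := fun w => if h : ∃ v, e₁ v = c w then h.choose else Classical.arbitrary V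
  have hz_old : ∀ w, (∃ v, e₁ v = c w) → e₁ (z w) = c w := by
    intro w h
    simp only [z, dif_pos h]
    exact h.choose_spec
  have hx : ∀ i, e₁ (x i) = e₂ (x₀ i) := fun i => (hH.eq_iff _ _).2 ⟨i, rfl⟩
  have hnew : ∀ w, ¬ (∃ v, e₁ v = c w) → ∃ j, e₂ (y₀ j) = c w := by
    intro w h
    obtain ⟨u, hu⟩ := (hH.mem (c w)).resolve_left h
    rcases hsurj u with ⟨i, rfl⟩ | ⟨j, rfl⟩
    · exact absurd ⟨x i, (hx i).trans hu⟩ h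
    · exact ⟨j, hu⟩
  obtain ⟨L, K, x', y', z', hK, hxy, hxz, hmeet⟩ := hz z
  rw [pattern_eq_iff] at hxy hxz
  have key : ∀ w, ∃ u, ((∃ v, e₁ v = c w) ∧ u = z' w) ∨
      (¬ (∃ v, e₁ v = c w) ∧ ∃ j, e₂ (y₀ j) = c w ∧ u = y' j) := by
    intro w
    by_cases h : ∃ v, e₁ v = c w
    · exact ⟨_, Or.inl ⟨h, rfl⟩⟩
    · obtain ⟨j, hj⟩ := hnew w h
      exact ⟨_, Or.inr ⟨h, j, hj, rfl⟩⟩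
  choose t ht using key
  -- An old and a new vertex do not collide since `y'` meets `z'` only in `x'`, and if they are
  -- adjacent then the old one is in the tuple `x`, over which the pattern of `y'` is prescribed.
  have hmixed : ∀ w, (∃ v, e₁ v = c w) → ∀ w', ¬ (∃ v, e₁ v = c w') → ∀ j, e₂ (y₀ j) = c w' →
      z' w ≠ y' j ∧ (H.Adj (c w) (c w') → K.Adj (z' w) (y' j)) := by
    intro w hw w' hw' j hj
    constructor
    · intro heq
      obtain ⟨i, hi⟩ := hmeet j w heq.symm
      have h1 : x₀ i = y₀ j := (hxy (Sum.inl i) (Sum.inr j)).1.1 (hi.trans heq)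
      exact hw' ⟨x i, by rw [hx, h1, hj]⟩
    · intro hadj
      obtain ⟨⟨u, hu⟩, -⟩ := (hH.adj _ _ hadj).resolve_left fun h => hw' h.2
      rw [← hz_old w hw] at hu hadj
      obtain ⟨i, hi⟩ := (hH.eq_iff _ _).1 hu.symm
      obtain ⟨hi1, hi2⟩ := Prod.ext_iff.1 hi
      simp only at hi1 hi2
      have h1 : x' i = z' w := (hxz (Sum.inl i) (Sum.inr w)).1.2 hi1
      rw [← hu, ← hi2, ← hj, e₂.map_adj_iff] at hadj
      rw [← h1]
      exact (hxy (Sum.inl i) (Sum.inr j)).2.2 hadj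
  refine hK ⟨⟨⟨t, fun {w w'} hww => ?_⟩, fun w w' hww => ?_⟩⟩
  · have hadj : H.Adj (c w) (c w') := c.toHom.map_adj hww
    rcases ht w with ⟨h, e⟩ | ⟨h, j, hj, e⟩ <;> rcases ht w' with ⟨h', e'⟩ | ⟨h', j', hj', e'⟩ <;>
      rw [e, e']
    · rw [← hz_old w h, ← hz_old w' h', e₁.map_adj_iff] at hadj
      exact (hxz (Sum.inr w) (Sum.inr w')).2.2 hadj
    · exact (hmixed w h w' h' j' hj').2 hadj
    · exact ((hmixed w' h' w h j hj).2 hadj.symm).symm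
    · rw [← hj, ← hj', e₂.map_adj_iff] at hadj
      exact (hxy (Sum.inr j) (Sum.inr j')).2.2 hadj
  · refine c.injective ?_
    change c w = c w'
    change t w = t w' at hww
    rcases ht w with ⟨h, e⟩ | ⟨h, j, hj, e⟩ <;> rcases ht w' with ⟨h', e'⟩ | ⟨h', j', hj', e'⟩ <;>
      rw [e, e'] at hww
    · rw [← hz_old w h, ← hz_old w' h']
      exact congrArg e₁ ((hxz (Sum.inr w) (Sum.inr w')).1.1 hww)
    · exact absurd hww (hmixed w h w' h' j' hj').1
    · exact absurd hww.symm (hmixed w' h' w h j hj).1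
    · rw [← hj, ← hj']
      exact congrArg e₂ ((hxy (Sum.inr j) (Sum.inr j')).1.1 hww)

/-- Cut a compatible graph down to `x₀` and `y₀`, glue it to `G` along `x`, and retract.
Compatibility, not closedness, makes this amalgam `C`-free. -/
lemma HasFiniteRetractions.exists_pattern_eq {V : Type u} [Countable V] [Nonempty V]
    {G : SimpleGraph V} (hG : HasFiniteRetractions C G) {ι κ : Type} [Finite ι] [Finite κ]
    {P : Pattern (ι ⊕ κ)} {x : ι → V}
    (hz : ∀ z : W → V, pattern G (Sum.elim x z) ∈ compatiblePatterns.{u} C P) :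
    ∃ y : κ → V, pattern G (Sum.elim x y) = P := by
  obtain ⟨L, K, x₀, y₀, z₀, -, hxy, hxz, -⟩ := hz fun _ => Classical.arbitrary V
  let S : Set L := Set.range x₀ ∪ Set.range y₀
  have : Countable S :=
    ((Set.finite_range x₀).union (Set.finite_range y₀)).countable.to_subtype
  let x₁ : ι → S := fun i => ⟨x₀ i, Or.inl ⟨i, rfl⟩⟩
  let y₁ : κ → S := fun j => ⟨y₀ j, Or.inr ⟨j, rfl⟩⟩
  have hxy₁ : pattern (K.induce S) (Sum.elim x₁ y₁) = P := by
    rw [← pattern_embedding (SimpleGraph.Embedding.induce S), Sum.comp_elim]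
    exact hxy
  have hx₁ : pattern G x = pattern (K.induce S) x₁ := by
    rw [← pattern_embedding (SimpleGraph.Embedding.induce S) x₁]
    exact (pattern_eq_of_elim hxz).symm
  rw [pattern_eq_iff] at hx₁
  have hp : IsPartialIso G (K.induce S) (Set.range fun i => (x i, x₁ i)) := by
    refine ⟨?_, ?_⟩
    · rintro _ ⟨i, rfl⟩ _ ⟨j, rfl⟩
      exact (hx₁ i j).1
    · rintro _ ⟨i, rfl⟩ _ ⟨j, rfl⟩
      exact (hx₁ i j).2
  obtain ⟨V', H, e₁, e₂, hH⟩ := hp.exists_isFreeAmalgam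
  have hfree : C.Free H := by
    refine free_of_isFreeAmalgam_of_compatible (y₀ := y₁) hH ?_ (by rwa [hxy₁])
    rintro ⟨u, ⟨i, rfl⟩ | ⟨j, rfl⟩⟩
    exacts [Or.inl ⟨i, rfl⟩, Or.inr ⟨j, rfl⟩]
  obtain ⟨h, hh, hfix⟩ := hG V' H e₁ ⟨hH.countable, hfree⟩
    (Set.range (e₁ ∘ x) ∪ Set.range (e₂ ∘ y₁)) ((Set.finite_range _).union (Set.finite_range _))
  refine ⟨h ∘ e₂ ∘ y₁, ?_⟩
  have hpat := hh.pattern_eq (s := Sum.elim (e₁ ∘ x) (e₂ ∘ y₁)) (by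
    rintro (i | j)
    exacts [Or.inl ⟨i, rfl⟩, Or.inr ⟨j, rfl⟩])
  have h1 : h ∘ Sum.elim (e₁ ∘ x) (e₂ ∘ y₁) = Sum.elim x (h ∘ e₂ ∘ y₁) := by
    rw [Sum.comp_elim]
    congr 1
    funext i
    exact hfix _ (Or.inl ⟨i, rfl⟩)
  have h2 : Sum.elim (e₁ ∘ x) (e₂ ∘ y₁) = e₂ ∘ Sum.elim x₁ y₁ := by
    rw [Sum.comp_elim]
    congr 1
    funext i
    exact (hH.eq_iff _ _).2 ⟨i, rfl⟩
  rw [h1, h2, pattern_embedding, hxy₁] at hpat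
  exact hpat

lemma exists_sentence_free [Finite W] (C : SimpleGraph W) : ∃ σ : Language.graph.Sentence,
    ∀ (V : Type u) (G : SimpleGraph V),
      @Sentence.Realize Language.graph V G.structure σ ↔ C.Free G := by
  -- With no `y`, no `z` and a void premise, the sentence merely says that no tuple indexed by `W`
  -- is a copy of `C`.
  obtain ⟨σ, hσ⟩ := exists_sentence_realize_iff.{u} (ι := W) (κ := Empty) (μ := Empty) Set.univ
    {Q | ¬ ((∀ i j, Q.1 (Sum.inl i) (Sum.inl j) → i = j) ∧
      ∀ i j, C.Adj i j → Q.2 (Sum.inl i) (Sum.inl j))}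
  refine ⟨σ, fun V G => (hσ V G).trans ⟨?_, ?_⟩⟩
  · rintro h ⟨c⟩
    obtain ⟨y, hy⟩ := h c fun _ => trivial
    exact hy ⟨fun i j hij => c.injective hij, fun i j hij => c.toHom.map_adj hij⟩
  · intro h x _
    exact ⟨Empty.elim, fun ⟨h1, h2⟩ => h ⟨⟨⟨x, fun {a b} hab => h2 a b hab⟩,
      fun a b hab => h1 a b hab⟩⟩⟩

/-- The countable models of the theory of the existentially complete graphs are existentially
complete graphs. -/
theorem exists_isExistentiallyComplete_of_model {n : ℕ} {V : Type u} [Countable V]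
    (S : Language.graph.Structure V)
    (hS : V ⊨ theoryOfExistentiallyComplete.{u} (cliqueWithTriangle n)) :
    ∃ G : SimpleGraph V, G.structure = S ∧
      IsExistentiallyComplete (cliqueWithTriangle n) G := by
  have hsg : V ⊨ Theory.simpleGraph := by
    refine ⟨fun φ hφ => hS.realize_of_mem φ fun V' G' _ => ?_⟩
    let := G'.structure
    exact (simpleGraph_model G').realize_of_mem φ hφ
  obtain ⟨G, rfl⟩ : ∃ G : SimpleGraph V, G.structure = S :=
    ⟨simpleGraphOfStructure V, structure_simpleGraphOfStructure⟩
  refine ⟨G, rfl, ?_⟩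
  have hfree : (cliqueWithTriangle n).Free G := by
    obtain ⟨σ, hσ⟩ := exists_sentence_free.{u} (cliqueWithTriangle n)
    exact (hσ V G).1 (hS.realize_of_mem σ fun V' G' hG' => (hσ V' G').2 hG'.1.2)
  refine HasFiniteRetractions.isExistentiallyComplete ?_ ⟨inferInstance, hfree⟩
  refine hasFiniteRetractions_of_axioms fun m k P x => ?_
  obtain ⟨σ, hσ⟩ := exists_sentence_realize_iff.{u}
    (compatiblePatterns.{u} (cliqueWithTriangle n) P) {P}
  refine (hσ V G).1 (hS.realize_of_mem σ fun V' G' hG' => (hσ V' G').2 fun x hx => ?_) x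
  have := hG'.nonempty
  have := hG'.1.1
  exact hG'.hasFiniteRetractions.exists_pattern_eq hx

lemma nonempty_equiv_of_iso {V V' : Type u} {G : SimpleGraph V} {H : SimpleGraph V'}
    (e : G ≃g H) :
    Nonempty (@Language.Equiv Language.graph V V' G.structure H.structure) := by
  let := G.structure
  let := H.structure
  refine ⟨⟨e.toEquiv, fun f => isEmptyElim f, fun {k} r x => ?_⟩⟩
  match k, r with
  | 2, .adj => exact e.map_adj_iff

end Axiomatization

/-! ### Categoricity and universality. -/

theorem isAleph0Categorical_theoryOfExistentiallyComplete {n : ℕ} (hn : 3 ≤ n) :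
    IsAleph0Categorical.{u} (theoryOfExistentiallyComplete.{u} (cliqueWithTriangle n)) := by
  constructor
  · have hE : IsCountableFree (cliqueWithTriangle n) (⊥ : SimpleGraph PEmpty.{u + 1}) :=
      ⟨inferInstance, fun ⟨c⟩ => (c ⟨0, by omega⟩).elim⟩
    obtain ⟨V, G, hG, -⟩ := exists_isExistentiallyComplete_embedding hE
    let := G.structure
    have := hG.nonempty
    have : V ⊨ theoryOfExistentiallyComplete.{u} (cliqueWithTriangle n) :=
      ⟨fun φ hφ => hφ V G hG⟩
    exact ⟨Language.Theory.ModelType.of _ V, hG.1.1⟩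
  · have key : ∀ (V V' : Type u) (S : Language.graph.Structure V)
        (S' : Language.graph.Structure V'),
        V ⊨ theoryOfExistentiallyComplete.{u} (cliqueWithTriangle n) →
        V' ⊨ theoryOfExistentiallyComplete.{u} (cliqueWithTriangle n) →
        Countable V → Countable V' → Nonempty (V ≃[Language.graph] V') := by
      intro V V' S S' hS hS' hV hV'
      obtain ⟨G, rfl, hG⟩ := exists_isExistentiallyComplete_of_model S hS
      obtain ⟨G', rfl, hG'⟩ := exists_isExistentiallyComplete_of_model S' hS'
      obtain ⟨e⟩ := hG.nonempty_iso hn hG'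
      exact nonempty_equiv_of_iso e
    exact fun M N hM hN => key M N _ _ M.is_model N.is_model hM hN

theorem exists_isUniversalFor {n : ℕ} (hn : 3 ≤ n) :
    ∃ (V : Type u) (U : SimpleGraph V), IsUniversalFor (cliqueWithTriangle n) U := by
  have hE : IsCountableFree (cliqueWithTriangle n) (⊥ : SimpleGraph PEmpty.{u + 1}) :=
    ⟨inferInstance, fun ⟨c⟩ => (c ⟨0, by omega⟩).elim⟩
  obtain ⟨V, U, hU, -⟩ := exists_isExistentiallyComplete_embedding hE
  refine ⟨V, U, hU.1, fun V' H hH => ?_⟩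
  obtain ⟨V'', H', hH', ⟨e⟩⟩ := exists_isExistentiallyComplete_embedding hH
  obtain ⟨f⟩ := hH'.nonempty_iso hn hU
  exact ⟨f.toEmbedding.comp e⟩

end UniversalGraphs

open UniversalGraphs
theorem lemma13 (n : ℕ) (hn : 3 ≤ n) :
    (∀ (V : Type u) (G : SimpleGraph V),
      IsExistentiallyComplete (cliqueWithTriangle n) G →
        (∀ A : Set V, A = acl G A ↔ ∀ a ∈ A, UniversalGraphs.star G n a ⊆ A) ∧
        (∀ a : V, (insert a (UniversalGraphs.star G n a)).encard ≤ (n : ℕ∞) + 1) ∧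
        (∀ A : Set V, (acl G A).encard ≤ ((n : ℕ∞) + 1) * A.encard)) ∧
    IsAleph0Categorical.{u} (theoryOfExistentiallyComplete.{u} (cliqueWithTriangle n)) ∧
    (∃ (V : Type u) (U : SimpleGraph V), IsUniversalFor (cliqueWithTriangle n) U) :=
  ⟨fun _ _ hG => ⟨hG.eq_acl_iff hn,
    ((isCountableFree_iff hn).1 hG.1).2.encard_insert_star_le hn, hG.encard_acl_le hn⟩,
    isAleph0Categorical_theoryOfExistentiallyComplete hn, exists_isUniversalFor hn⟩
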